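/- Let $\mathcal R$ be the family of all axis-parallel rectangles $[x_1,x_2]\times[y_1,y_2]$ in $\mathbb R^2$. A coloring $\mathrm{col}:S\to\mathbb N$ of a finite set $S\subset\mathbb R^2$ is conflict-free with respect to $\mathcal R$ if every $R\in\mathcal R$ with $R\cap S\neq\emptyset$ contains a point of $S$ whose color differs from the colors of all other points of $S\cap R$. Consider a finite point set in the plane that, starting from an arbitrary finite set $S_0$, undergoes an arbitrary sequence of updates, each of which inserts a point not in the current set or deletes a point of the current set. The updates are revealed one at a time, and after each update a strategy, which knows $S_0$ and the updates made so far but not the future ones, must provide a coloring of the current set. The number of recolorings of an update is the number of points present both before and after the update whose color changes. There is an absolute constant $C$ such that for every finite $S_0\subset\mathbb R^2$ there is a deterministic strategy with the following properties for every sequence of updates. 1. At any time (also before the first update) the coloring of the current set is conflict-free with respect to $\mathcal R$. 2. At any time at which the current number $n$ of points is at least $2$, the number of colors used on the current set is at most $C\sqrt n\,\log^2 n$. 3. Each insertion causes at most $C\log n$ recolorings, where $n$ is the number of points after the insertion. 4. Each deletion causes at most $C$ recolorings. -/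

import Mathlib

noncomputable section

namespace DynamicCF

/-- Points of the plane. -/
abbrev Point : Type := ℝ × ℝ

/-- The family of all (closed) axis-parallel rectangles `[x₁, x₂] × [y₁, y₂]` in the plane.
Degenerate rectangles (segments and single points) are included. -/
def rectangles : Set (Set Point) :=
  {R | ∃ x₁ x₂ y₁ y₂ : ℝ, x₁ ≤ x₂ ∧ y₁ ≤ y₂ ∧ R = Set.Icc x₁ x₂ ×ˢ Set.Icc y₁ y₂}

/-- A coloring `col` of the finite point set `S` is conflict-free with respect to the family `F`
of ranges if every range of `F` that contains at least one point of `S` contains a point of `S`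
whose color is different from the colors of all other points of `S` in the range. -/
def IsConflictFree (F : Set (Set Point)) (S : Finset Point) (col : Point → ℕ) : Prop :=
  ∀ R ∈ F, (∃ p ∈ S, p ∈ R) →
    ∃ p ∈ S, p ∈ R ∧ ∀ q ∈ S, q ∈ R → q ≠ p → col q ≠ col p

/-- An update of a dynamic point set. -/
inductive Update : Type
  | insert (p : Point)
  | delete (p : Point)

/-- The point set after performing an update on `S`. -/
def Update.apply : Update → Finset Point → Finset Point
  | .insert p, S => Insert.insert p S
  | .delete p, S => S.erase p

/-- Only new points are inserted, and only present points are deleted. -/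
def Update.IsAdmissible : Update → Finset Point → Prop
  | .insert p, S => p ∉ S
  | .delete p, S => p ∈ S

/-- A history is the list of the updates performed so far, the most recent update first. -/
abbrev History : Type := List Update

/-- The current point set, when the updates of the history are performed starting from `S₀`. -/
def currentSet (S₀ : Finset Point) : History → Finset Point
  | [] => S₀
  | u :: h => u.apply (currentSet S₀ h)

/-- Every update of the history was admissible at the time it was performed. -/
def IsValid (S₀ : Finset Point) : History → Prop
  | [] => True
  | u :: h => IsValid S₀ h ∧ u.IsAdmissible (currentSet S₀ h)

/-- A (deterministic, online) recoloring strategy: the current coloring is determined by the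
updates performed so far. Only the colors of the points of the current set matter. -/
abbrev Strategy : Type := History → Point → ℕ

/-- The number of colors that `col` uses on `S`. -/
def numColors (S : Finset Point) (col : Point → ℕ) : ℕ := (S.image col).card

/-- The number of recolorings that the strategy performs for the update `u` after the history `h`:
the number of points present both before and after the update whose color changes. -/
def numRecolorings (S₀ : Finset Point) (σ : Strategy) (u : Update) (h : History) : ℕ :=
  ((currentSet S₀ h ∩ currentSet S₀ (u :: h)).filter fun p => σ h p ≠ σ (u :: h) p).card

end DynamicCF

end

/-! ### Layered colorings: conflict-freeness and deletion -/

namespace DynamicCF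

/-! Split the set into y-monotone chains, ordered lexicographically, and give each chain levels such
that between two points of equal level lies a higher one. A rectangle meets a chain in an interval,
where the maximal level occurs once (`Layered.isConflictFree`). A greedy partition into about `2√n`
chains and antichains with ruler levels uses `O(√n log n)` colors (`exists_layered`). Deleting a
point only requires its chain successor to inherit its color, if that raises the successor's level
(`Layered.erase`).

Insertions use a deamortized logarithmic method. The points inserted at times in `(s - 2^i, s]`,
with `2^i ∣ s`, form a block of level `i`, colored statically at time `s` with its own palette. Its
points join one at a time in lexicographic order, one per insertion, so they have all left the lower
levels before the next block of level `i` starts. The coloring covers the pending points too. Those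
already present form an initial segment (`WellFormed.lower`), hence are layered by themselves, and
removing a pending point changes no visible color. So a move recolors only the point and one
neighbor in the block it leaves (`WellFormed.move`). An insertion makes `O(log n)` moves, and each
level has at most four blocks in use (`OnSchedule.lt_pos_add`).

Time is kept bounded by phases. The points present at the start of a phase keep their old coloring
and move, two per update, to a fresh static coloring. Once none is left, the old palette is unused
and the current coloring becomes the old coloring of the next phase (`State.Valid.refresh`). -/

/-- A coloring is layered if the colors determine a partition into chains, each of them convex with
respect to rectangles, and a level function that is unimax along each chain. -/
def Layered (T : Finset Point) (c : Point → ℕ) : Prop :=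
  ∃ ch lv : Point → ℕ,
    (∀ p ∈ T, ∀ q ∈ T, c p = c q → ch p = ch q ∧ lv p = lv q) ∧
    (∀ p ∈ T, ∀ r ∈ T, ∀ q ∈ T, ch p = ch r → ch r = ch q → toLex p < toLex r →
      toLex r < toLex q → r.2 ∈ Set.uIcc p.2 q.2) ∧
    (∀ p ∈ T, ∀ q ∈ T, ch p = ch q → lv p = lv q → toLex p < toLex q →
      ∃ r ∈ T, toLex p < toLex r ∧ toLex r < toLex q ∧ ch r = ch p ∧ lv p < lv r)

lemma fst_le_of_toLex_lt {p q : Point} (h : toLex p < toLex q) : p.1 ≤ q.1 := by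
  rcases Prod.Lex.toLex_lt_toLex.1 h with h | h
  · exact h.le
  · exact h.1.le

/-- Take a chain that meets the rectangle. By convexity, a higher point between two points of the
chain in the rectangle is also in it, so the maximal level is attained once. Since colors determine
chain and level, that point has a unique color. -/
lemma Layered.isConflictFree {S : Finset Point} {c : Point → ℕ} (h : Layered S c) :
    IsConflictFree rectangles S c := by
  classical
  obtain ⟨ch, lv, hc, hconv, huni⟩ := h
  rintro R ⟨x₁, x₂, y₁, y₂, -, -, rfl⟩ ⟨p₀, hp₀, hp₀R⟩
  set R : Set Point := Set.Icc x₁ x₂ ×ˢ Set.Icc y₁ y₂ with hR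
  obtain ⟨p, hp, hmax⟩ := Finset.exists_max_image
    (S.filter fun p => p ∈ R ∧ ch p = ch p₀) lv ⟨p₀, by simp [hp₀, hp₀R]⟩
  simp only [Finset.mem_filter] at hp hmax
  have key : ∀ a ∈ S, ∀ b ∈ S, a ∈ R → b ∈ R → ch a = ch p₀ → ch b = ch p₀ →
      lv a = lv b → lv a = lv p → ¬ toLex a < toLex b := by
    intro a ha b hb haR hbR hca hcb hl hlp hlt
    obtain ⟨r, hr, har, hrb, hcr, hlr⟩ := huni a ha b hb (hca.trans hcb.symm) hl hlt
    have hy := hconv a ha r hr b hb hcr.symm (hcr.trans (hca.trans hcb.symm)) har hrb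
    have hrR : r ∈ R := by
      refine ⟨⟨haR.1.1.trans (fst_le_of_toLex_lt har),
        (fst_le_of_toLex_lt hrb).trans hbR.1.2⟩, ?_⟩
      exact Set.uIcc_subset_Icc haR.2 hbR.2 hy
    have := hmax r ⟨hr, hrR, hcr.trans hca⟩
    omega
  refine ⟨p, hp.1, hp.2.1, fun q hq hqR hne heq => ?_⟩
  obtain ⟨h1, h2⟩ := hc q hq p hp.1 heq
  rcases lt_trichotomy (toLex q) (toLex p) with h | h | h
  · exact key q hq p hp.1 hqR hp.2.1 (h1.trans hp.2.2) hp.2.2 h2 h2 h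
  · exact hne (toLex.injective h)
  · exact key p hp.1 q hq hp.2.1 hqR hp.2.2 (h1.trans hp.2.2) h2.symm rfl h

/-- After the deletion of a point, only the color of its successor in its chain changes. -/
lemma Layered.erase {T : Finset Point} {c : Point → ℕ} (h : Layered T c) {p : Point}
    (hp : p ∈ T) :
    ∃ c' : Point → ℕ, Layered (T.erase p) c' ∧ (T.erase p).image c' ⊆ T.image c ∧
      ∃ a : Point, (∀ r, r ≠ a → c' r = c r) ∧ (c' = c ∨ a ∈ T ∧ toLex p < toLex a) := by
  classical
  obtain ⟨ch, lv, hc, hconv, huni⟩ := h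
  have hsub : T.erase p ⊆ T := Finset.erase_subset _ _
  have hne : ∀ r, r ∈ T.erase p ↔ r ≠ p ∧ r ∈ T := fun r => Finset.mem_erase
  have hle : ∀ {x y : Point}, toLex x ≤ toLex y → x ≠ y → toLex x < toLex y :=
    fun h h' => lt_of_le_of_ne h fun e => h' (toLex.injective e)
  have hconv' : ∀ x ∈ T.erase p, ∀ r ∈ T.erase p, ∀ q ∈ T.erase p, ch x = ch r → ch r = ch q →
      toLex x < toLex r → toLex r < toLex q → r.2 ∈ Set.uIcc x.2 q.2 :=
    fun x hx r hr q hq => hconv x (hsub hx) r (hsub hr) q (hsub hq)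
  by_cases hex : ∃ b ∈ T, ch b = ch p ∧ toLex p < toLex b
  · obtain ⟨b₀, hb₀, hb₀c, hb₀p⟩ := hex
    obtain ⟨a, ha, hmin⟩ := Finset.exists_min_image
      (T.filter fun b => ch b = ch p ∧ toLex p < toLex b) toLex ⟨b₀, by simp [hb₀, hb₀c, hb₀p]⟩
    simp only [Finset.mem_filter] at ha hmin
    obtain ⟨haT, hac, hpa⟩ := ha
    have hane : a ≠ p := by rintro rfl; exact lt_irrefl _ hpa
    rcases lt_or_ge (lv a) (lv p) with hlv | hlv
    -- The lower successor `a` takes over color and level of `p`, as if `p` had slid into its place.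
    · refine ⟨Function.update c a (c p), ⟨ch, Function.update lv a (lv p), ?_, hconv', ?_⟩, ?_, a,
        fun r hr => Function.update_of_ne hr _ _, Or.inr ⟨haT, hpa⟩⟩
      · intro x hx y hy hxy
        by_cases hxa : x = a <;> by_cases hya : y = a
        · subst hxa; subst hya; simp
        · subst hxa
          rw [Function.update_self, Function.update_of_ne hya] at hxy
          rw [Function.update_self, Function.update_of_ne hya, hac]
          exact hc p hp y (hsub hy) hxy
        · subst hya
          rw [Function.update_self, Function.update_of_ne hxa] at hxy
          rw [Function.update_self, Function.update_of_ne hxa, hac]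
          exact hc x (hsub hx) p hp hxy
        · rw [Function.update_of_ne hxa, Function.update_of_ne hya] at hxy ⊢
          exact hc x (hsub hx) y (hsub hy) hxy
      · intro x hx y hy hch hl hlt
        have hxT := hsub hx
        have hyT := hsub hy
        by_cases hxa : x = a
        · subst hxa
          have hya : y ≠ x := by rintro rfl; exact lt_irrefl _ hlt
          rw [Function.update_self, Function.update_of_ne hya] at hl
          obtain ⟨r, hr, h1, h2, h3, h4⟩ := huni p hp y hyT (hac.symm.trans hch) hl
            (hpa.trans hlt)
          have hrx : r ≠ x := by rintro rfl; omega
          refine ⟨r, (hne r).2 ⟨by rintro rfl; exact lt_irrefl _ h1, hr⟩,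
            hle (hmin r ⟨hr, h3, h1⟩) hrx.symm, h2, h3.trans hac.symm, ?_⟩
          rwa [Function.update_self, Function.update_of_ne hrx]
        · by_cases hya : y = a
          · subst hya
            rw [Function.update_self, Function.update_of_ne hxa] at hl
            have hxp : toLex x < toLex p := by
              by_contra hcon
              have h1 : toLex p < toLex x := hle (not_lt.1 hcon) ((hne x).1 hx).1.symm
              exact absurd (hmin x ⟨hxT, hch.trans hac, h1⟩) (not_le.2 hlt)
            obtain ⟨r, hr, h1, h2, h3, h4⟩ := huni x hxT p hp (hch.trans hac) hl hxp
            have hry : r ≠ y := by rintro rfl; exact lt_asymm h2 hpa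
            refine ⟨r, (hne r).2 ⟨by rintro rfl; exact lt_irrefl _ h2, hr⟩, h1, h2.trans hpa,
              h3, ?_⟩
            rwa [Function.update_of_ne hxa, Function.update_of_ne hry]
          · rw [Function.update_of_ne hxa, Function.update_of_ne hya] at hl
            obtain ⟨r, hr, h1, h2, h3, h4⟩ := huni x hxT y hyT hch hl hlt
            rw [Function.update_of_ne hxa]
            by_cases hrp : r = p
            · subst hrp
              have hay : toLex a < toLex y :=
                hle (hmin y ⟨hyT, hch.symm.trans h3.symm, h2⟩) (Ne.symm hya)
              refine ⟨a, (hne a).2 ⟨hane, haT⟩, h1.trans hpa, hay, hac.trans h3, ?_⟩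
              rwa [Function.update_self]
            · refine ⟨r, (hne r).2 ⟨hrp, hr⟩, h1, h2, h3, ?_⟩
              by_cases hra : r = a
              · subst hra
                rw [Function.update_self]; omega
              · rwa [Function.update_of_ne hra]
      · intro k hk
        obtain ⟨x, hx, rfl⟩ := Finset.mem_image.1 hk
        by_cases hxa : x = a
        · subst hxa
          rw [Function.update_self]; exact Finset.mem_image_of_mem _ hp
        · rw [Function.update_of_ne hxa]; exact Finset.mem_image_of_mem _ (hsub hx)
    -- Here `a` is at least as high as `p` and separates whatever `p` separated.
    · refine ⟨c, ⟨ch, lv, fun x hx y hy => hc x (hsub hx) y (hsub hy), hconv', ?_⟩,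
        Finset.image_subset_image hsub, p, fun _ _ => rfl, Or.inl rfl⟩
      intro x hx y hy hch hl hlt
      obtain ⟨r, hr, h1, h2, h3, h4⟩ := huni x (hsub hx) y (hsub hy) hch hl hlt
      by_cases hrp : r = p
      · subst hrp
        have hya : y ≠ a := by rintro rfl; omega
        exact ⟨a, (hne a).2 ⟨hane, haT⟩, h1.trans hpa,
          hle (hmin y ⟨hsub hy, hch.symm.trans h3.symm, h2⟩) hya.symm, hac.trans h3, by omega⟩
      · exact ⟨r, (hne r).2 ⟨hrp, hr⟩, h1, h2, h3, h4⟩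
  -- The last point of a chain separates no pair.
  · refine ⟨c, ⟨ch, lv, fun x hx y hy => hc x (hsub hx) y (hsub hy), hconv', ?_⟩,
      Finset.image_subset_image hsub, p, fun _ _ => rfl, Or.inl rfl⟩
    intro x hx y hy hch hl hlt
    obtain ⟨r, hr, h1, h2, h3, h4⟩ := huni x (hsub hx) y (hsub hy) hch hl hlt
    by_cases hrp : r = p
    · subst hrp
      exact absurd ⟨y, hsub hy, hch.symm.trans h3.symm, h2⟩ hex
    · exact ⟨r, (hne r).2 ⟨hrp, hr⟩, h1, h2, h3, h4⟩

/-! ### Static sets: monotone partitions and ruler colorings -/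

/-- Either there is a chain with `k + 1` elements or a partition into `k` antichains. -/
lemma exists_chain_or_antichains {α : Type*} [PartialOrder α] [DecidableEq α] (k : ℕ) :
    ∀ T : Finset α,
      (∃ A ⊆ T, A.card = k + 1 ∧ ∀ p ∈ A, ∀ q ∈ A, p ≤ q ∨ q ≤ p) ∨
      ∃ g : α → ℕ, (∀ p ∈ T, g p < k) ∧ ∀ p ∈ T, ∀ q ∈ T, g p = g q → p ≤ q → p = q := by
  classical
  induction k with
  | zero =>
    intro T
    rcases T.eq_empty_or_nonempty with rfl | ⟨p, hp⟩
    · exact Or.inr ⟨fun _ => 0, by simp, by simp⟩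
    · exact Or.inl ⟨{p}, by simpa using hp, by simp, by simp⟩
  | succ k ih =>
    intro T
    -- The minimal elements form one antichain, and a chain of nonminimal elements can be extended
    -- downwards.
    rcases ih (T.filter fun p => ∃ q ∈ T, q < p) with ⟨A, hA, hcard, hchain⟩ | ⟨g, hg, hanti⟩
    · left
      obtain ⟨m, hm, hmin⟩ := A.exists_minimal (Finset.card_pos.1 (by omega))
      obtain ⟨q, hq, hqm⟩ := (Finset.mem_filter.1 (hA hm)).2
      have hlt : ∀ p ∈ A, q < p := fun p hp => by
        rcases hchain m hm p hp with h | h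
        · exact hqm.trans_le h
        · exact hqm.trans_le (hmin hp h)
      refine ⟨insert q A, ?_, ?_, ?_⟩
      · intro p hp
        rcases Finset.mem_insert.1 hp with rfl | hp
        · exact hq
        · exact (Finset.mem_filter.1 (hA hp)).1
      · rw [Finset.card_insert_of_notMem fun h => lt_irrefl _ (hlt q h), hcard]
      · intro p hp r hr
        rcases Finset.mem_insert.1 hp with hp | hp <;> rcases Finset.mem_insert.1 hr with hr | hr
        · exact Or.inl (hp.trans hr.symm).le
        · exact Or.inl (hp ▸ (hlt r hr).le)
        · exact Or.inr (hr ▸ (hlt p hp).le)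
        · exact hchain p hp r hr
    · right
      refine ⟨fun p => if ∃ q ∈ T, q < p then g p else k, fun p hp => ?_,
        fun p hp q hq hpq hle => ?_⟩
      · dsimp only
        split_ifs with h
        · exact (hg p (Finset.mem_filter.2 ⟨hp, h⟩)).trans (Nat.lt_succ_self k)
        · exact Nat.lt_succ_self k
      · dsimp only at hpq
        by_cases h1 : ∃ r ∈ T, r < p
        · have h2 : ∃ r ∈ T, r < q := by
            obtain ⟨r, hr, hrp⟩ := h1
            exact ⟨r, hr, hrp.trans_le hle⟩
          rw [if_pos h1, if_pos h2] at hpq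
          exact hanti p (Finset.mem_filter.2 ⟨hp, h1⟩) q (Finset.mem_filter.2 ⟨hq, h2⟩) hpq hle
        · by_cases h2 : ∃ r ∈ T, r < q
          · rw [if_neg h1, if_pos h2] at hpq
            have := hg q (Finset.mem_filter.2 ⟨hq, h2⟩)
            omega
          · by_contra hne
            exact h2 ⟨p, hp, lt_of_le_of_ne hle hne⟩

/-- A partition into few classes, each of which is a chain or an antichain. -/
lemma exists_monotone_partition {α : Type*} [PartialOrder α] [DecidableEq α] (k : ℕ)
    (T : Finset α) :
    ∃ (g : α → ℕ) (N : ℕ), (∀ p ∈ T, g p < N) ∧ N * (k + 1) ≤ k * (k + 1) + T.card ∧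
      ∀ i, (∀ p ∈ T, ∀ q ∈ T, g p = i → g q = i → p ≤ q ∨ q ≤ p) ∨
        ∀ p ∈ T, ∀ q ∈ T, g p = i → g q = i → p ≤ q → p = q := by
  classical
  induction hm : T.card using Nat.strong_induction_on generalizing T with
  | _ m ih =>
    -- Chains of `k + 1` elements are split off greedily until `k` antichains suffice for the rest.
    rcases exists_chain_or_antichains k T with ⟨A, hA, hcard, hchain⟩ | ⟨g, hg, hanti⟩
    · have hlt : (T \ A).card + (k + 1) = m := by
        rw [← hm, ← hcard, Finset.card_sdiff_add_card_eq_card hA]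
      obtain ⟨g, N, hg, hN, hmono⟩ := ih _ (by omega) (T \ A) rfl
      refine ⟨fun p => if p ∈ A then N else g p, N + 1, fun p hp => ?_, ?_, fun i => ?_⟩
      · dsimp only
        split_ifs with h
        · omega
        · exact (hg p (Finset.mem_sdiff.2 ⟨hp, h⟩)).trans (Nat.lt_succ_self N)
      · rw [add_mul, one_mul]; omega
      · by_cases hi : i = N
        · have hin : ∀ p ∈ T, (if p ∈ A then N else g p) = i → p ∈ A := by
            intro p hp h
            by_contra hpA
            rw [if_neg hpA] at h
            have := hg p (Finset.mem_sdiff.2 ⟨hp, hpA⟩)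
            omega
          exact Or.inl fun p hp q hq h1 h2 => hchain p (hin p hp h1) q (hin q hq h2)
        · have hin : ∀ p ∈ T, (if p ∈ A then N else g p) = i → p ∈ T \ A ∧ g p = i := by
            intro p hp h
            by_cases hpA : p ∈ A
            · rw [if_pos hpA] at h
              exact absurd h.symm hi
            · rw [if_neg hpA] at h
              exact ⟨Finset.mem_sdiff.2 ⟨hp, hpA⟩, h⟩
          rcases hmono i with h | h
          · exact Or.inl fun p hp q hq h1 h2 => h p (hin p hp h1).1 q (hin q hq h2).1
              (hin p hp h1).2 (hin q hq h2).2
          · exact Or.inr fun p hp q hq h1 h2 => h p (hin p hp h1).1 q (hin q hq h2).1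
              (hin p hp h1).2 (hin q hq h2).2
    · exact ⟨g, k, hg, by omega, fun i =>
        Or.inr fun p hp q hq h1 h2 => hanti p hp q hq (h1.trans h2.symm)⟩

/-- Both numbers are odd multiples of the same power `2 ^ a`, so the next multiple of `2 ^ a` after
`i` is an even one and still lies below `j`. -/
lemma padicValNat_add_pow_lt {i j : ℕ} (hi : i ≠ 0) (hij : i < j)
    (h : padicValNat 2 i = padicValNat 2 j) :
    i + 2 ^ padicValNat 2 i < j ∧ padicValNat 2 i < padicValNat 2 (i + 2 ^ padicValNat 2 i) := by
  set a := padicValNat 2 i with ha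
  have hj : j ≠ 0 := by omega
  obtain ⟨x, hx⟩ : 2 ^ a ∣ i := pow_padicValNat_dvd
  obtain ⟨y, hy⟩ : 2 ^ a ∣ j := by rw [h]; exact pow_padicValNat_dvd
  have hxo : ¬ 2 ∣ x := by
    rintro ⟨z, rfl⟩
    exact pow_succ_padicValNat_not_dvd (p := 2) hi ⟨z, by rw [← ha, pow_succ, mul_assoc]; exact hx⟩
  have hyo : ¬ 2 ∣ y := by
    rintro ⟨z, rfl⟩
    exact pow_succ_padicValNat_not_dvd (p := 2) hj ⟨z, by rw [← h, pow_succ, mul_assoc]; exact hy⟩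
  have hpos : 0 < 2 ^ a := by positivity
  have hxy : x < y := by
    rw [hx, hy] at hij
    exact lt_of_mul_lt_mul_left hij (Nat.zero_le _)
  constructor
  · rw [hx, hy]
    have : x + 1 < y := by omega
    calc 2 ^ a * x + 2 ^ a = 2 ^ a * (x + 1) := by ring
      _ < 2 ^ a * y := Nat.mul_lt_mul_of_pos_left this hpos
  · have hdvd : 2 ^ (a + 1) ∣ i + 2 ^ a := by
      obtain ⟨z, hz⟩ : 2 ∣ x + 1 := by omega
      refine ⟨z, ?_⟩
      rw [pow_succ, mul_assoc, ← hz]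
      nlinarith
    have := (padicValNat_dvd_iff_le (p := 2) (a := i + 2 ^ a) (n := a + 1) (by omega)).1 hdvd
    omega

/-- The ruler coloring of a linearly ordered set. -/
lemma exists_ruler (T : Finset Point) (g : Point → ℕ) :
    ∃ lv : Point → ℕ, (∀ p ∈ T, lv p ≤ Nat.log 2 T.card) ∧
      ∀ p ∈ T, ∀ q ∈ T, g p = g q → lv p = lv q → toLex p < toLex q →
        ∃ r ∈ T, toLex p < toLex r ∧ toLex r < toLex q ∧ g r = g p ∧ lv p < lv r := by
  classical
  set rank : Point → ℕ := fun p => (T.filter fun q => g q = g p ∧ toLex q ≤ toLex p).card with hrank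
  have hpos : ∀ p ∈ T, 0 < rank p := fun p hp =>
    Finset.card_pos.2 ⟨p, Finset.mem_filter.2 ⟨hp, rfl, le_rfl⟩⟩
  have hlt : ∀ p ∈ T, ∀ q ∈ T, g p = g q → toLex p < toLex q → rank p < rank q := by
    intro p hp q hq hg h
    refine Finset.card_lt_card (Finset.ssubset_iff_subset_ne.2 ⟨fun r hr => ?_, fun he => ?_⟩)
    · obtain ⟨h1, h2, h3⟩ := Finset.mem_filter.1 hr
      exact Finset.mem_filter.2 ⟨h1, h2.trans hg, h3.trans h.le⟩
    · have : q ∈ T.filter fun r => g r = g p ∧ toLex r ≤ toLex p := by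
        rw [he]; exact Finset.mem_filter.2 ⟨hq, rfl, le_rfl⟩
      exact absurd (Finset.mem_filter.1 this).2.2 (not_le.2 h)
  have hinj : ∀ p ∈ T, ∀ q ∈ T, g p = g q → rank p < rank q → toLex p < toLex q := by
    intro p hp q hq hg h
    by_contra hcon
    rcases (not_lt.1 hcon).lt_or_eq with h' | h'
    · exact absurd (hlt q hq p hp hg.symm h') (by omega)
    · rw [toLex.injective h'] at h; exact lt_irrefl _ h
  -- Ranks in a class have no gaps, so the intermediate number of higher valuation is the rank of
  -- some point.
  have hsurj : ∀ q ∈ T, ∀ u, 0 < u → u ≤ rank q → ∃ r ∈ T, g r = g q ∧ rank r = u := by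
    intro q hq u hu huq
    obtain ⟨r, hr, hru⟩ := Finset.surj_on_of_inj_on_of_card_le
      (s := T.filter fun r => g r = g q ∧ toLex r ≤ toLex q) (t := Finset.Icc 1 (rank q))
      (fun r _ => rank r)
      (fun r hr => by
        obtain ⟨h1, h2, h3⟩ := Finset.mem_filter.1 hr
        refine Finset.mem_Icc.2 ⟨hpos r h1, ?_⟩
        rcases h3.lt_or_eq with h | h
        · exact (hlt r h1 q hq h2 h).le
        · rw [toLex.injective h])
      (fun r r' hr hr' h => by
        obtain ⟨h1, h2, -⟩ := Finset.mem_filter.1 hr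
        obtain ⟨h1', h2', -⟩ := Finset.mem_filter.1 hr'
        rcases lt_trichotomy (toLex r) (toLex r') with h' | h' | h'
        · exact absurd (hlt r h1 r' h1' (h2.trans h2'.symm) h') (by omega)
        · exact toLex.injective h'
        · exact absurd (hlt r' h1' r h1 (h2'.trans h2.symm) h') (by omega))
      (by simp [hrank]) u (Finset.mem_Icc.2 ⟨hu, huq⟩)
    obtain ⟨h1, h2, -⟩ := Finset.mem_filter.1 hr
    exact ⟨r, h1, h2, hru.symm⟩
  refine ⟨fun p => padicValNat 2 (rank p), fun p hp => ?_, fun p hp q hq hg hl h => ?_⟩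
  · exact (padicValNat_le_nat_log _).trans
      (Nat.log_mono_right (Finset.card_le_card (Finset.filter_subset _ _)))
  · obtain ⟨h1, h2⟩ := padicValNat_add_pow_lt (hpos p hp).ne' (hlt p hp q hq hg h) hl
    have hpow : 0 < 2 ^ padicValNat 2 (rank p) := by positivity
    obtain ⟨r, hr, hgr, hrr⟩ := hsurj q hq _ (by omega) h1.le
    refine ⟨r, hr, hinj p hp r hr (hg.trans hgr.symm) (by omega),
      hinj r hr q hq hgr (by omega), hgr.trans hg.symm, ?_⟩
    dsimp only
    rwa [hrr]

/-- The number of colors that suffices for a static set of `m` points. -/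
def staticBound (m : ℕ) : ℕ := 2 * Nat.sqrt m * (Nat.log 2 m + 1)

lemma staticBound_mono : Monotone staticBound := fun a b h => by
  unfold staticBound
  gcongr

/-- Choosing `k = ⌊√|T|⌋` balances antichains against chains and gives at most `2k` classes. In
lexicographic order, chains have weakly increasing and antichains weakly decreasing second
coordinates, so both are convex. -/
lemma exists_layered (T : Finset Point) :
    ∃ c : Point → ℕ, Layered T c ∧ (T.image c).card ≤ staticBound T.card := by
  classical
  obtain ⟨g, N, hg, hN, hmono⟩ := exists_monotone_partition (Nat.sqrt T.card) T
  obtain ⟨lv, hlv, huni⟩ := exists_ruler T g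
  refine ⟨fun p => Nat.pair (g p) (lv p), ⟨g, lv, fun p _ q _ h => Nat.pair_eq_pair.1 h, ?_, huni⟩,
    ?_⟩
  · intro p hp r hr q hq h1 h2 hpr hrq
    rcases hmono (g r) with h | h
    · have mono : ∀ x ∈ T, ∀ y ∈ T, g x = g r → g y = g r → toLex x < toLex y → x.2 ≤ y.2 := by
        intro x hx y hy hgx hgy hlt
        rcases h x hx y hy hgx hgy with h | h
        · exact h.2
        · rcases Prod.Lex.toLex_lt_toLex.1 hlt with h' | h'
          · exact absurd h.1 (not_le.2 h')
          · exact h'.2.le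
      exact Set.mem_uIcc.2 (Or.inl ⟨mono p hp r hr h1 rfl hpr, mono r hr q hq rfl h2.symm hrq⟩)
    · have anti : ∀ x ∈ T, ∀ y ∈ T, g x = g r → g y = g r → toLex x < toLex y → y.2 ≤ x.2 := by
        intro x hx y hy hgx hgy hlt
        by_contra hcon
        have := h x hx y hy hgx hgy ⟨fst_le_of_toLex_lt hlt, (not_le.1 hcon).le⟩
        rw [this] at hlt
        exact lt_irrefl _ hlt
      exact Set.mem_uIcc.2 (Or.inr ⟨anti r hr q hq rfl h2.symm hrq, anti p hp r hr h1 rfl hpr⟩)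
  · have hN' : N ≤ 2 * Nat.sqrt T.card := by
      have := Nat.lt_succ_sqrt T.card
      rw [Nat.succ_eq_add_one] at this
      by_contra hcon
      have : (2 * Nat.sqrt T.card + 1) * (Nat.sqrt T.card + 1) ≤ N * (Nat.sqrt T.card + 1) :=
        Nat.mul_le_mul_right _ (by omega)
      nlinarith
    calc (T.image fun p => Nat.pair (g p) (lv p)).card
        ≤ ((Finset.range N ×ˢ Finset.range (Nat.log 2 T.card + 1)).image
            fun x => Nat.pair x.1 x.2).card := by
          refine Finset.card_le_card fun k hk => ?_
          obtain ⟨p, hp, rfl⟩ := Finset.mem_image.1 hk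
          exact Finset.mem_image.2 ⟨(g p, lv p), Finset.mem_product.2
            ⟨Finset.mem_range.2 (hg p hp), Finset.mem_range.2 (Nat.lt_succ_of_le (hlv p hp))⟩, rfl⟩
      _ ≤ N * (Nat.log 2 T.card + 1) := by
          refine Finset.card_image_le.trans ?_
          simp
      _ ≤ _ := Nat.mul_le_mul_right _ hN'


/-! ### Dyadic blocks and layouts -/

/-- The least multiple of `2 ^ i` that is at least `a`. -/
def blockEnd (i a : ℕ) : ℕ := 2 ^ i * ((a + 2 ^ i - 1) / 2 ^ i)

lemma le_blockEnd (i a : ℕ) : a ≤ blockEnd i a := by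
  have h := Nat.div_add_mod (a + 2 ^ i - 1) (2 ^ i)
  have hpos : 0 < 2 ^ i := by positivity
  have h' := Nat.mod_lt (a + 2 ^ i - 1) hpos
  unfold blockEnd
  omega

lemma blockEnd_lt (i a : ℕ) : blockEnd i a < a + 2 ^ i := by
  have h := Nat.div_add_mod (a + 2 ^ i - 1) (2 ^ i)
  have hpos : 0 < 2 ^ i := by positivity
  unfold blockEnd
  omega

lemma dvd_blockEnd (i a : ℕ) : 2 ^ i ∣ blockEnd i a := Dvd.intro _ rfl

@[simp] lemma blockEnd_zero_left (a : ℕ) : blockEnd 0 a = a := by simp [blockEnd]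

@[simp] lemma blockEnd_zero_right (i : ℕ) : blockEnd i 0 = 0 := by
  have h := blockEnd_lt i 0
  rw [zero_add] at h
  exact Nat.eq_zero_of_dvd_of_lt (dvd_blockEnd i 0) h

lemma blockEnd_eq_zero {i a : ℕ} : blockEnd i a = 0 ↔ a = 0 :=
  ⟨fun h => by have := le_blockEnd i a; omega, fun h => by rw [h, blockEnd_zero_right]⟩

/-- A distribution of points over blocks. Every point `p` has a time of insertion `τ p` and a level
`lvl p`; it also is a candidate for the blocks of the higher levels. -/
structure Layout where
  /-- the current time -/
  t : ℕ
  /-- an upper bound for the colors of the initial block -/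
  N : ℕ
  /-- times of insertion, zero for initial points -/
  τ : Point → ℕ
  /-- levels -/
  lvl : Point → ℕ
  /-- the colorings of the blocks -/
  c : ℕ → ℕ → Point → ℕ

namespace Layout

variable (L : Layout) (S : Finset Point)

/-- The block of level `i` for the times of insertion in `(s - 2 ^ i, s]`. -/
def block (i s : ℕ) : Finset Point := S.filter fun p => blockEnd i (L.τ p) = s ∧ L.lvl p ≤ i

/-- The points of a block which still are at a lower level. -/
def pending (i s : ℕ) : Finset Point := (L.block S i s).filter fun p => L.lvl p < i

/-- The second index of the block where a point is located. -/
def pos (p : Point) : ℕ := blockEnd (L.lvl p) (L.τ p)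

/-- The color of a point. -/
def color (p : Point) : ℕ :=
  if L.lvl p = 0 ∧ L.τ p = 0 then L.c 0 0 p
  else L.N + Nat.pair (Nat.pair (L.lvl p) (L.pos p)) (L.c (L.lvl p) (L.pos p) p)

variable {L S}

lemma mem_block {i s : ℕ} {p : Point} :
    p ∈ L.block S i s ↔ p ∈ S ∧ blockEnd i (L.τ p) = s ∧ L.lvl p ≤ i := by
  simp [block]

lemma mem_pending {i s : ℕ} {p : Point} :
    p ∈ L.pending S i s ↔ p ∈ S ∧ blockEnd i (L.τ p) = s ∧ L.lvl p < i := by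
  simp only [pending, Finset.mem_filter, mem_block]
  exact ⟨fun h => ⟨h.1.1, h.1.2.1, h.2⟩, fun h => ⟨⟨h.1, h.2.1, h.2.2.le⟩, h.2.2⟩⟩

lemma mem_block_self {p : Point} (hp : p ∈ S) : p ∈ L.block S (L.lvl p) (L.pos p) :=
  mem_block.2 ⟨hp, rfl, le_rfl⟩

/-- The invariants of layouts, for `n₀` initial points whose old coloring has `m` colors. -/
structure WellFormed (L : Layout) (S : Finset Point) (n₀ m : ℕ) : Prop where
  started : ∀ p ∈ S, L.pos p ≤ L.t
  layered : ∀ i s, s ≤ L.t → Layered (L.block S i s) (L.c i s)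
  lower : ∀ i s, s ≤ L.t → ∀ p ∈ L.block S i s, ∀ q ∈ L.block S i s, toLex q < toLex p →
    L.lvl p = i → L.lvl q = i
  old_lt : ∀ p ∈ L.block S 0 0, L.c 0 0 p < L.N
  old_lvl : ∀ p ∈ S, L.τ p = 0 → L.lvl p ≤ 1
  τ_inj : ∀ p ∈ S, ∀ q ∈ S, L.τ p = L.τ q → L.τ p ≠ 0 → p = q
  palette : ∀ i s, 0 < s → s ≤ L.t → ((L.block S i s).image (L.c i s)).card ≤ staticBound (2 ^ i)
  palette_top : ((L.block S 1 0).image (L.c 1 0)).card ≤ staticBound n₀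
  palette_old : ((L.block S 0 0).image (L.c 0 0)).card ≤ m

variable {n₀ m : ℕ}

lemma WellFormed.τ_le (h : L.WellFormed S n₀ m) {p : Point} (hp : p ∈ S) : L.τ p ≤ L.t :=
  (le_blockEnd _ _).trans (h.started p hp)

/-- The coloring that a layout defines is layered. -/
lemma WellFormed.layered_color (h : L.WellFormed S n₀ m) : Layered S L.color := by
  classical
  have hex : ∀ i s, ∃ ch lv : Point → ℕ, s ≤ L.t →
    (∀ p ∈ L.block S i s, ∀ q ∈ L.block S i s, L.c i s p = L.c i s q →
      ch p = ch q ∧ lv p = lv q) ∧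
    (∀ p ∈ L.block S i s, ∀ r ∈ L.block S i s, ∀ q ∈ L.block S i s, ch p = ch r → ch r = ch q →
      toLex p < toLex r → toLex r < toLex q → r.2 ∈ Set.uIcc p.2 q.2) ∧
    (∀ p ∈ L.block S i s, ∀ q ∈ L.block S i s, ch p = ch q → lv p = lv q → toLex p < toLex q →
      ∃ r ∈ L.block S i s, toLex p < toLex r ∧ toLex r < toLex q ∧ ch r = ch p ∧ lv p < lv r) := by
    intro i s
    by_cases hs : s ≤ L.t
    · obtain ⟨ch, lv, H⟩ := h.layered i s hs
      exact ⟨ch, lv, fun _ => H⟩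
    · exact ⟨fun _ => 0, fun _ => 0, fun h => absurd h hs⟩
  choose ch lv H using hex
  have hold : ∀ p ∈ S, L.lvl p = 0 ∧ L.τ p = 0 → L.color p < L.N := by
    intro p hp hp0
    rw [color, if_pos hp0]
    exact h.old_lt p (mem_block.2 ⟨hp, by simp [hp0.2], by simp [hp0.1]⟩)
  have hnew : ∀ p, ¬(L.lvl p = 0 ∧ L.τ p = 0) → L.N ≤ L.color p := by
    intro p hp
    rw [color, if_neg hp]
    exact Nat.le_add_right _ _
  have hmem : ∀ p ∈ S, ∀ q, L.lvl p = L.lvl q → L.pos p = L.pos q →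
      p ∈ L.block S (L.lvl q) (L.pos q) := by
    intro p hp q h1 h2
    rw [← h1, ← h2]
    exact mem_block_self hp
  refine ⟨fun p => Nat.pair (Nat.pair (L.lvl p) (L.pos p)) (ch (L.lvl p) (L.pos p) p),
    fun p => lv (L.lvl p) (L.pos p) p, ?_, ?_, ?_⟩
  · intro p hp q hq hpq
    have : L.lvl p = L.lvl q ∧ L.pos p = L.pos q ∧
        L.c (L.lvl q) (L.pos q) p = L.c (L.lvl q) (L.pos q) q := by
      by_cases h1 : L.lvl p = 0 ∧ L.τ p = 0 <;> by_cases h2 : L.lvl q = 0 ∧ L.τ q = 0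
      · rw [color, color, if_pos h1, if_pos h2] at hpq
        simp [pos, h1.1, h1.2, h2.1, h2.2, hpq]
      · have := hold p hp h1
        have := hnew q h2
        omega
      · have := hold q hq h2
        have := hnew p h1
        omega
      · rw [color, color, if_neg h1, if_neg h2] at hpq
        obtain ⟨h3, h4⟩ := Nat.pair_eq_pair.1 (Nat.add_left_cancel hpq)
        obtain ⟨h5, h6⟩ := Nat.pair_eq_pair.1 h3
        rw [h5, h6] at h4
        exact ⟨h5, h6, h4⟩
    obtain ⟨h1, h2, h3⟩ := this
    obtain ⟨h4, h5⟩ := (H _ _ (h.started q hq)).1 p (hmem p hp q h1 h2) q (mem_block_self hq) h3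
    dsimp only
    rw [h1, h2, h4, h5]
    exact ⟨rfl, rfl⟩
  · intro p hp r hr q hq h1 h2 h3 h4
    obtain ⟨h5, h6⟩ := Nat.pair_eq_pair.1 h1
    obtain ⟨h5, h5'⟩ := Nat.pair_eq_pair.1 h5
    obtain ⟨h7, h8⟩ := Nat.pair_eq_pair.1 h2
    obtain ⟨h7, h7'⟩ := Nat.pair_eq_pair.1 h7
    rw [h5, h5'] at h6
    rw [← h7, ← h7'] at h8
    exact (H _ _ (h.started r hr)).2.1 p (hmem p hp r h5 h5') r (mem_block_self hr) q
      (hmem q hq r h7.symm h7'.symm) h6 h8 h3 h4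
  · intro p hp q hq h1 h2 h3
    dsimp only at h2
    obtain ⟨h5, h6⟩ := Nat.pair_eq_pair.1 h1
    obtain ⟨h5, h5'⟩ := Nat.pair_eq_pair.1 h5
    rw [h5, h5'] at h6 h2
    obtain ⟨r, hr, h7, h8, h9, h10⟩ := (H _ _ (h.started q hq)).2.2 p (hmem p hp q h5 h5') q
      (mem_block_self hq) h6 h2 h3
    -- The separating point could be merely pending, but it precedes `q`, so `lower` places it at
    -- the level of `q`.
    have hlr := h.lower _ _ (h.started q hq) q (mem_block_self hq) r hr h8 rfl
    have hpr : L.pos r = L.pos q := by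
      rw [pos, hlr]
      exact (mem_block.1 hr).2.1
    refine ⟨r, (mem_block.1 hr).1, h7, h8, ?_, ?_⟩
    · dsimp only
      rw [hlr, hpr, h5, h5', h9]
    · dsimp only
      rw [hlr, hpr, h5, h5']
      exact h10

/-- The removal of a point from some blocks changes the color of at most one other point. -/
lemma WellFormed.exists_erase (h : L.WellFormed S n₀ m) (p : Point)
    (K : ℕ → Prop) [DecidablePred K] :
    ∃ c' : ℕ → ℕ → Point → ℕ,
      (∀ i s, s ≤ L.t →
        Layered (if K i then (L.block S i s).erase p else L.block S i s) (c' i s) ∧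
        (if K i then (L.block S i s).erase p else L.block S i s).image (c' i s) ⊆
          (L.block S i s).image (L.c i s)) ∧
      ∃ a : Point, ∀ i s, s ≤ L.t → ∀ r ∈ L.block S i s, r ≠ a → L.lvl r = i →
        c' i s r = L.c i s r := by
  classical
  have hex : ∀ i s, ∃ (c' : Point → ℕ) (a : Point), s ≤ L.t →
      Layered (if K i then (L.block S i s).erase p else L.block S i s) c' ∧
      (if K i then (L.block S i s).erase p else L.block S i s).image c' ⊆
          (L.block S i s).image (L.c i s) ∧
      ∀ r ∈ L.block S i s, (r ≠ a ∨ ¬(L.lvl p = i ∧ L.pos p = s)) → L.lvl r = i →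
        c' r = L.c i s r := by
    intro i s
    by_cases hs : s ≤ L.t
    · by_cases hK : K i ∧ p ∈ L.block S i s
      · simp only [hK.1, if_true]
        obtain ⟨c', h1, h2, a, h3, h4⟩ := (h.layered i s hs).erase hK.2
        refine ⟨c', a, fun _ => ⟨h1, h2, fun r hr hra hri => ?_⟩⟩
        by_cases hra' : r = a
        · subst hra'
          rcases h4 with h4 | ⟨h4, h5⟩
          · rw [h4]
          -- A recolored point visible in this block is preceded by `p`, so `lower` would make this
          -- the block where `p` is located.
          · exfalso
            have hpi := h.lower i s hs r hr p hK.2 h5 hri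
            refine hra.resolve_left (fun h => h rfl) ⟨hpi, ?_⟩
            rw [pos, hpi]
            exact (mem_block.1 hK.2).2.1
        · exact h3 r hra'
      · have : (if K i then (L.block S i s).erase p else L.block S i s) = L.block S i s := by
          split_ifs with hKi
          · exact Finset.erase_eq_of_notMem fun hpb => hK ⟨hKi, hpb⟩
          · rfl
        rw [this]
        exact ⟨L.c i s, p, fun _ => ⟨h.layered i s hs, subset_rfl, fun _ _ _ _ => rfl⟩⟩
    · exact ⟨fun _ => 0, p, fun h => absurd h hs⟩
  choose c' a H using hex
  refine ⟨c', fun i s hs => ⟨(H i s hs).1, (H i s hs).2.1⟩, a (L.lvl p) (L.pos p),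
    fun i s hs r hr hra hri => (H i s hs).2.2 r hr ?_ hri⟩
  by_cases hps : L.lvl p = i ∧ L.pos p = s
  · left
    rwa [← hps.1, ← hps.2]
  · exact Or.inr hps

end Layout

/-! ### Recolorings caused by deletions and moves -/

/-- The number of points of a set on which two colorings differ. -/
def changes (A : Finset Point) (f g : Point → ℕ) : ℕ := (A.filter fun p => f p ≠ g p).card

lemma changes_triangle (A : Finset Point) (f g k : Point → ℕ) :
    changes A f k ≤ changes A f g + changes A g k := by
  classical
  unfold changes
  refine (Finset.card_le_card fun p hp => ?_).trans (Finset.card_union_le _ _)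
  simp only [Finset.mem_union, Finset.mem_filter] at hp ⊢
  by_cases hfg : f p = g p
  · exact Or.inr ⟨hp.1, fun h => hp.2 (hfg.trans h)⟩
  · exact Or.inl ⟨hp.1, hfg⟩

lemma changes_mono {A B : Finset Point} (h : A ⊆ B) (f g : Point → ℕ) :
    changes A f g ≤ changes B f g :=
  Finset.card_le_card (Finset.filter_subset_filter _ h)

lemma changes_eq_zero {A : Finset Point} {f g : Point → ℕ} (h : ∀ p ∈ A, f p = g p) :
    changes A f g = 0 := by
  simp only [changes, Finset.card_eq_zero, Finset.filter_eq_empty_iff, not_not]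
  exact fun p hp => h p hp

lemma changes_le_card {A B : Finset Point} {f g : Point → ℕ} (h : ∀ p ∈ A, p ∉ B → f p = g p) :
    changes A f g ≤ B.card :=
  Finset.card_le_card fun p hp => by
    by_contra hB
    exact (Finset.mem_filter.1 hp).2 (h p (Finset.mem_filter.1 hp).1 hB)

namespace Layout

variable {L : Layout} {S : Finset Point} {n₀ m : ℕ}

/-- Deleting a point costs at most one recoloring. -/
lemma WellFormed.delete (h : L.WellFormed S n₀ m) (p : Point) :
    ∃ L' : Layout, L'.WellFormed (S.erase p) n₀ m ∧ L'.t = L.t ∧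
      (∀ i s, L'.pending (S.erase p) i s ⊆ L.pending S i s) ∧
      changes (S.erase p) L.color L'.color ≤ 1 := by
  classical
  obtain ⟨c', hc', a, ha⟩ := h.exists_erase p (fun _ => True)
  simp only [if_true] at hc'
  set L' : Layout := { L with c := c' } with hL'
  have hblock : ∀ i s, L'.block (S.erase p) i s = (L.block S i s).erase p := by
    intro i s
    ext q
    simp only [mem_block, Finset.mem_erase, hL']
    tauto
  have hsub : S.erase p ⊆ S := Finset.erase_subset _ _
  have hbsub : ∀ i s, L'.block (S.erase p) i s ⊆ L.block S i s := fun i s => by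
    rw [hblock]; exact Finset.erase_subset _ _
  have himg : ∀ i s, s ≤ L.t → ((L'.block (S.erase p) i s).image (c' i s)) ⊆
      (L.block S i s).image (L.c i s) := fun i s hs => by
    rw [hblock]; exact (hc' i s hs).2
  refine ⟨L', ⟨fun q hq => h.started q (hsub hq), fun i s hs => ?_, ?_, ?_,
    fun q hq => h.old_lvl q (hsub hq), fun q hq r hr => h.τ_inj q (hsub hq) r (hsub hr), ?_, ?_, ?_⟩,
    rfl, ?_, ?_⟩
  · rw [hblock]; exact (hc' i s hs).1
  · intro i s hs q hq r hr
    exact h.lower i s hs q (hbsub i s hq) r (hbsub i s hr)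
  · intro q hq
    obtain ⟨r, hr, hrq⟩ := Finset.mem_image.1
      (himg 0 0 (Nat.zero_le _) (Finset.mem_image_of_mem (c' 0 0) hq))
    show c' 0 0 q < L.N
    rw [← hrq]
    exact h.old_lt r hr
  · exact fun i s hs hst => (Finset.card_le_card (himg i s hst)).trans (h.palette i s hs hst)
  · exact (Finset.card_le_card (himg 1 0 (Nat.zero_le _))).trans h.palette_top
  · exact (Finset.card_le_card (himg 0 0 (Nat.zero_le _))).trans h.palette_old
  · intro i s q hq
    simp only [mem_pending, hL', Finset.mem_erase] at hq ⊢
    exact ⟨hq.1.2, hq.2⟩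
  · refine (changes_le_card (B := {a}) fun q hq hqa => ?_).trans (by simp)
    have hqS := hsub hq
    have key := ha (L.lvl q) (L.pos q) (h.started q hqS) q (mem_block_self hqS) (by simpa using hqa)
      rfl
    by_cases hold : L.lvl q = 0 ∧ L.τ q = 0
    · rw [color, color, if_pos hold, if_pos hold]
      simp only [pos, hold.1, hold.2, blockEnd_zero_right] at key
      exact key.symm
    · rw [color, color, if_neg hold, if_neg hold]
      show _ = L.N + Nat.pair (Nat.pair (L.lvl q) (L.pos q)) (c' (L.lvl q) (L.pos q) q)
      rw [key]

/-- Moving a pending point into its block costs at most two recolorings. -/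
lemma WellFormed.move (h : L.WellFormed S n₀ m) {i s : ℕ} (hs : s ≤ L.t) (hi : s = 0 → i ≤ 1) :
    ∃ L' : Layout, L'.WellFormed S n₀ m ∧ L'.t = L.t ∧
      (∀ j u, (L'.pending S j u).card ≤ (L.pending S j u).card) ∧
      (L'.pending S i s).card ≤ (L.pending S i s).card - 1 ∧
      changes S L.color L'.color ≤ 2 := by
  classical
  rcases (L.pending S i s).eq_empty_or_nonempty with he | hne
  · exact ⟨L, h, rfl, fun _ _ => le_rfl, by simp [he], by simp [changes]⟩
  -- The lexicographically first pending point is chosen so that the points located in the block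
  -- remain an initial segment.
  obtain ⟨p, hpP, hmin⟩ := Finset.exists_min_image _ toLex hne
  obtain ⟨hp, hps, hpi⟩ := mem_pending.1 hpP
  obtain ⟨c', hc', a, ha⟩ := h.exists_erase p (fun j => j < i)
  set L' : Layout := { L with c := c', lvl := Function.update L.lvl p i } with hL'
  have hlp : L'.lvl p = i := Function.update_self _ _ _
  have hlq : ∀ q, q ≠ p → L'.lvl q = L.lvl q := fun q hq => Function.update_of_ne hq _ _
  have hle : ∀ q, L.lvl q ≤ L'.lvl q := fun q => by
    by_cases hq : q = p
    · rw [hq, hlp]; exact hpi.le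
    · rw [hlq q hq]
  have hblock : ∀ j u, L'.block S j u =
      if j < i then (L.block S j u).erase p else L.block S j u := by
    intro j u
    ext q
    have : q ∈ L'.block S j u ↔ q ∈ S ∧ blockEnd j (L.τ q) = u ∧ L'.lvl q ≤ j := mem_block
    rw [this]
    by_cases hq : q = p
    · subst hq
      rw [hlp]
      split_ifs with hji
      · simp [hji]
      · simp only [mem_block]
        constructor
        · exact fun h => ⟨h.1, h.2.1, by omega⟩
        · exact fun h => ⟨h.1, h.2.1, by omega⟩
    · rw [hlq q hq]
      split_ifs with hji
      · simp [mem_block, hq]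
      · rw [mem_block]
  have hbsub : ∀ j u, L'.block S j u ⊆ L.block S j u := fun j u => by
    rw [hblock]
    split_ifs
    · exact Finset.erase_subset _ _
    · exact subset_rfl
  have himg : ∀ j u, u ≤ L.t → ((L'.block S j u).image (c' j u)) ⊆
      (L.block S j u).image (L.c j u) := fun j u hu => by
    rw [hblock]; exact (hc' j u hu).2
  have hpend : ∀ j u, L'.pending S j u ⊆ L.pending S j u := by
    intro j u q hq
    obtain ⟨h1, h2, h3⟩ := mem_pending.1 hq
    exact mem_pending.2 ⟨h1, h2, (hle q).trans_lt h3⟩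
  refine ⟨L', ⟨fun q hq => ?_, fun j u hu => ?_, ?_, ?_, fun q hq h0 => ?_,
    fun q hq r hr => h.τ_inj q hq r hr, ?_, ?_, ?_⟩,
    rfl, fun j u => Finset.card_le_card (hpend j u), ?_, ?_⟩
  · by_cases hqp : q = p
    · rw [pos, hqp, hlp]
      show blockEnd i (L.τ p) ≤ L.t
      rwa [hps]
    · rw [pos, hlq q hqp]
      exact h.started q hq
  · rw [hblock]; exact (hc' j u hu).1
  · intro j u hu q hq r hr hrq hqj
    have hqL := hbsub j u hq
    have hrL := hbsub j u hr
    by_cases hqp : q = p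
    · subst hqp
      have hji : j = i := hqj.symm.trans hlp
      subst hji
      have hrq' : r ≠ q := by rintro rfl; exact lt_irrefl _ hrq
      rw [hlq r hrq']
      by_contra hne'
      have hu' : u = s := (mem_block.1 hqL).2.1.symm.trans hps
      have : r ∈ L.pending S j s :=
        mem_pending.2 ⟨(mem_block.1 hrL).1, (mem_block.1 hrL).2.1.trans hu',
          lt_of_le_of_ne (mem_block.1 hrL).2.2 hne'⟩
      exact absurd (hmin r this) (not_le.2 hrq)
    · rw [hlq q hqp] at hqj
      have hrj := h.lower j u hu q hqL r hrL hrq hqj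
      by_cases hrp : r = p
      · subst hrp
        have := (mem_block.1 hr).2.2
        rw [hlp] at this ⊢
        omega
      · rw [hlq r hrp, hrj]
  · intro q hq
    obtain ⟨r, hr, hrq⟩ := Finset.mem_image.1
      (himg 0 0 (Nat.zero_le _) (Finset.mem_image_of_mem (c' 0 0) hq))
    show c' 0 0 q < L.N
    rw [← hrq]
    exact h.old_lt r hr
  · by_cases hqp : q = p
    · rw [hqp, hlp]
      apply hi
      have h0' : L.τ q = 0 := h0
      rw [← hps, ← hqp, h0', blockEnd_zero_right]
    · rw [hlq q hqp]
      exact h.old_lvl q hq h0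
  · exact fun j u hu hut => (Finset.card_le_card (himg j u hut)).trans (h.palette j u hu hut)
  · exact (Finset.card_le_card (himg 1 0 (Nat.zero_le _))).trans h.palette_top
  · exact (Finset.card_le_card (himg 0 0 (Nat.zero_le _))).trans h.palette_old
  · rw [← Finset.card_erase_of_mem hpP]
    refine Finset.card_le_card fun q hq => Finset.mem_erase.2 ⟨?_, hpend i s hq⟩
    rintro rfl
    have := (mem_pending.1 hq).2.2
    omega
  -- Only `p` and possibly its successor in the block that it leaves change color.
  · refine (changes_le_card (B := {a, p}) fun q hqS hqa => ?_).trans Finset.card_le_two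
    simp only [Finset.mem_insert, Finset.mem_singleton, not_or] at hqa
    have key := ha (L.lvl q) (L.pos q) (h.started q hqS) q (mem_block_self hqS) hqa.1 rfl
    have hq' := hlq q hqa.2
    have hpos : L'.pos q = L.pos q := by rw [pos, hq']; rfl
    have hτ : L'.τ q = L.τ q := rfl
    by_cases hold : L.lvl q = 0 ∧ L.τ q = 0
    · rw [color, color, hq', hτ, if_pos hold, if_pos hold]
      simp only [pos, hold.1, hold.2, blockEnd_zero_right] at key
      exact key.symm
    · rw [color, color, hq', hτ, if_neg hold, if_neg hold, hpos]
      show _ = L.N + Nat.pair (Nat.pair (L.lvl q) (L.pos q)) (c' (L.lvl q) (L.pos q) q)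
      rw [key]

/-- A block may occur repeatedly in the list; each occurrence moves one pending point, if any is
left. -/
lemma WellFormed.moves (l : List (ℕ × ℕ)) :
    ∀ L : Layout, L.WellFormed S n₀ m → (∀ b ∈ l, b.2 ≤ L.t ∧ (b.2 = 0 → b.1 ≤ 1)) →
    ∃ L' : Layout, L'.WellFormed S n₀ m ∧ L'.t = L.t ∧
      (∀ j u, (L'.pending S j u).card ≤ (L.pending S j u).card - l.count (j, u)) ∧
      changes S L.color L'.color ≤ 2 * l.length := by
  classical
  induction l with
  | nil => exact fun L h _ => ⟨L, h, rfl, by simp, by simp [changes]⟩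
  | cons b l ih =>
    intro L h hb
    obtain ⟨hb1, hb2⟩ := hb b List.mem_cons_self
    obtain ⟨L₁, h₁, ht₁, hp₁, hpb₁, hc₁⟩ := h.move hb1 hb2
    obtain ⟨L₂, h₂, ht₂, hp₂, hc₂⟩ := ih L₁ h₁ fun x hx => by
      rw [ht₁]; exact hb x (List.mem_cons_of_mem _ hx)
    refine ⟨L₂, h₂, ht₂.trans ht₁, fun j u => ?_, ?_⟩
    · rw [List.count_cons]
      have h3 := hp₂ j u
      have h4 := hp₁ j u
      split_ifs with hbe
      · have : b = (j, u) := by simpa using hbe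
        subst this
        dsimp only at hpb₁
        omega
      · omega
    · have := changes_triangle S L.color L₁.color L₂.color
      rw [List.length_cons]
      omega

end Layout
-- Insertions, the schedule and the number of colors
namespace Layout

variable {L : Layout} {S : Finset Point} {n₀ m : ℕ}

/-- For `s > 0` the points of a block have distinct nonzero insertion times in a window of length `2
^ i`. Times are shifted by `2 ^ i` to avoid truncated subtraction. -/
lemma card_block_le (h : ∀ p ∈ S, ∀ q ∈ S, L.τ p = L.τ q → L.τ p ≠ 0 → p = q) {i s : ℕ}
    (hs : 0 < s) :
    (L.block S i s).card ≤ 2 ^ i := by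
  have hmem : ∀ p ∈ L.block S i s, L.τ p ≠ 0 ∧ L.τ p ≤ s ∧ s < L.τ p + 2 ^ i := by
    intro p hp
    have hps := (mem_block.1 hp).2.1
    have h1 := le_blockEnd i (L.τ p)
    have h2 := blockEnd_lt i (L.τ p)
    refine ⟨fun h0 => ?_, by omega, by omega⟩
    rw [h0, blockEnd_zero_right] at hps
    omega
  have : (L.block S i s).card ≤ (Finset.Ico (s + 1) (s + 1 + 2 ^ i)).card :=
    Finset.card_le_card_of_injOn (fun p => L.τ p + 2 ^ i)
      (fun p hp => by
        have := hmem p hp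
        simp only [Finset.coe_Ico, Set.mem_Ico]
        omega)
      (fun p hp q hq hpq => h p (mem_block.1 hp).1 q (mem_block.1 hq).1
        (Nat.add_right_cancel hpq) (hmem p hp).1)
  simpa using this

/-- Pending points of a block disappear in time. -/
def OnSchedule (L : Layout) (S : Finset Point) : Prop :=
  ∀ i s, 0 < s → s ≤ L.t → (L.pending S i s).card ≤ 2 ^ i - (L.t - s)

/-- A new point can be given a block of its own. -/
lemma WellFormed.add (h : L.WellFormed S n₀ m) {p : Point} (hp : p ∉ S) :
    ∃ L' : Layout, L'.WellFormed (insert p S) n₀ m ∧ L'.t = L.t + 1 ∧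
      (∀ i s, s ≤ L.t → L'.pending (insert p S) i s = L.pending S i s) ∧
      ∀ q ∈ S, L'.color q = L.color q := by
  classical
  choose k hk hkc using exists_layered
  set τ' := Function.update L.τ p (L.t + 1) with hτ'
  set l' := Function.update L.lvl p 0 with hl'
  -- These are the blocks that start at the new time; `B i` is empty unless `2 ^ i` divides `L.t +
  -- 1`.
  set B : ℕ → Finset Point := fun i =>
    (insert p S).filter fun q => blockEnd i (τ' q) = L.t + 1 ∧ l' q ≤ i with hB
  set L' : Layout := { L with
    t := L.t + 1, τ := τ', lvl := l', c := fun i s => if s = L.t + 1 then k (B i) else L.c i s }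
    with hL'
  have hτp : L'.τ p = L.t + 1 := Function.update_self _ _ _
  have hlp : L'.lvl p = 0 := Function.update_self _ _ _
  have hne : ∀ q ∈ S, q ≠ p := fun q hq h => hp (h ▸ hq)
  have hτq : ∀ q ∈ S, L'.τ q = L.τ q := fun q hq => Function.update_of_ne (hne q hq) _ _
  have hlq : ∀ q ∈ S, L'.lvl q = L.lvl q := fun q hq => Function.update_of_ne (hne q hq) _ _
  have hpq : ∀ q ∈ S, L'.pos q = L.pos q := fun q hq => by rw [pos, pos, hτq q hq, hlq q hq]
  have hc : ∀ i s, s ≤ L.t → L'.c i s = L.c i s := fun i s hs => if_neg (by omega)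
  have hcnew : ∀ i, L'.c i (L.t + 1) = k (B i) := fun i => if_pos rfl
  have hblock : ∀ i s, s ≤ L.t → L'.block (insert p S) i s = L.block S i s := by
    intro i s hs
    ext q
    simp only [mem_block, Finset.mem_insert]
    constructor
    · rintro ⟨rfl | hq, h1, h2⟩
      · have := le_blockEnd i (L'.τ q)
        omega
      · rw [hτq q hq] at h1
        rw [hlq q hq] at h2
        exact ⟨hq, h1, h2⟩
    · rintro ⟨hq, h1, h2⟩
      rw [hτq q hq, hlq q hq]
      exact ⟨Or.inr hq, h1, h2⟩
  have hnew : ∀ i, L'.block (insert p S) i (L.t + 1) = B i := fun i => rfl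
  have hpp : L'.pos p = L.t + 1 := by rw [pos, hlp, hτp, blockEnd_zero_left]
  have hcases : ∀ s, s ≤ L'.t → s ≤ L.t ∨ s = L.t + 1 := by
    intro s hs
    have : L'.t = L.t + 1 := rfl
    omega
  have hτ_inj : ∀ q ∈ insert p S, ∀ r ∈ insert p S, L'.τ q = L'.τ r → L'.τ q ≠ 0 → q = r := by
    intro q hq r hr hqr h0
    rcases Finset.mem_insert.1 hq with hq | hq <;> rcases Finset.mem_insert.1 hr with hr | hr
    · rw [hq, hr]
    · rw [hq, hτp, hτq r hr] at hqr
      have := h.τ_le hr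
      omega
    · rw [hr, hτp, hτq q hq] at hqr
      have := h.τ_le hq
      omega
    · rw [hτq q hq, hτq r hr] at hqr
      rw [hτq q hq] at h0
      exact h.τ_inj q hq r hr hqr h0
  have hBcard : ∀ i, (B i).card ≤ 2 ^ i := fun i =>
    card_block_le (L := L') hτ_inj (Nat.succ_pos L.t)
  refine ⟨L', ⟨?_, ?_, ?_, ?_, ?_, hτ_inj, ?_, ?_, ?_⟩, rfl, ?_, ?_⟩
  · intro q hq
    rcases Finset.mem_insert.1 hq with rfl | hq
    · exact hpp.le
    · rw [hpq q hq]
      exact (h.started q hq).trans (Nat.le_succ _)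
  · intro i s hs
    rcases hcases s hs with hs | rfl
    · rw [hblock i s hs, hc i s hs]
      exact h.layered i s hs
    · rw [hnew, hcnew]
      exact hk _
  · intro i s hs q hq r hr hrq hqi
    rcases hcases s hs with hs | rfl
    · rw [hblock i s hs] at hq hr
      rw [hlq q (mem_block.1 hq).1] at hqi
      rw [hlq r (mem_block.1 hr).1]
      exact h.lower i s hs q hq r hr hrq hqi
    -- Earlier points are located in blocks that started by time `L.t`, so a new block of positive
    -- level consists of pending points only.
    · have hi : i = 0 := by
        obtain ⟨h1, h2, -⟩ := mem_block.1 hq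
        rcases Finset.mem_insert.1 h1 with rfl | h1
        · rw [← hqi, hlp]
        · rw [← hqi] at h2
          have h3 := h.started q h1
          rw [← hpq q h1, pos] at h3
          omega
      have := (mem_block.1 hr).2.2
      omega
  · intro q hq
    rw [hblock 0 0 (Nat.zero_le _)] at hq
    rw [hc 0 0 (Nat.zero_le _)]
    exact h.old_lt q hq
  · intro q hq h0
    rcases Finset.mem_insert.1 hq with rfl | hq
    · rw [hlp]; exact Nat.zero_le _
    · rw [hτq q hq] at h0
      rw [hlq q hq]
      exact h.old_lvl q hq h0
  · intro i s hs hst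
    rcases hcases s hst with hst | rfl
    · rw [hblock i s hst, hc i s hst]
      exact h.palette i s hs hst
    · rw [hnew, hcnew]
      exact (hkc _).trans (staticBound_mono (hBcard i))
  · rw [hblock 1 0 (Nat.zero_le _), hc 1 0 (Nat.zero_le _)]
    exact h.palette_top
  · rw [hblock 0 0 (Nat.zero_le _), hc 0 0 (Nat.zero_le _)]
    exact h.palette_old
  · intro i s hs
    rw [pending, pending, hblock i s hs]
    refine Finset.filter_congr fun q hq => ?_
    rw [hlq q (mem_block.1 hq).1]
  · intro q hq
    rw [color, color, hlq q hq, hτq q hq, hpq q hq, hc _ _ (h.started q hq),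
      hc 0 0 (Nat.zero_le _)]

/-- An insertion costs two recolorings per level. -/
lemma WellFormed.insert (h : L.WellFormed S n₀ m) (hd : L.OnSchedule S) {p : Point} (hp : p ∉ S) :
    ∃ L' : Layout, L'.WellFormed (insert p S) n₀ m ∧ L'.OnSchedule (insert p S) ∧
      L'.t = L.t + 1 ∧
      (L'.pending (insert p S) 1 0).card ≤ (L.pending S 1 0).card ∧
      changes S L.color L'.color ≤ 2 * Nat.log 2 L.t := by
  classical
  obtain ⟨L₁, h₁, ht₁, hp₁, hc₁⟩ := h.add hp
  have hpow : ∀ i, 1 ≤ i → i ≤ Nat.log 2 L.t → 2 ^ i ≤ L.t := fun i h1 h2 =>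
    Nat.pow_le_of_le_log (by rintro h0; simp [h0] at h2; omega) h2
  -- One move is made into the latest block of each level that had started before this insertion.
  set l : List (ℕ × ℕ) := (List.range' 1 (Nat.log 2 L.t)).map fun i => (i, 2 ^ i * (L.t / 2 ^ i))
    with hl
  obtain ⟨L₂, h₂, ht₂, hp₂, hc₂⟩ := h₁.moves l L₁ fun b hb => by
    obtain ⟨i, hi, rfl⟩ := List.mem_map.1 hb
    rw [List.mem_range'_1] at hi
    have hle := hpow i hi.1 (by omega)
    refine ⟨?_, fun h0 => ?_⟩
    · rw [ht₁]
      exact (Nat.mul_div_le _ _).trans (Nat.le_succ _)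
    · have : 0 < L.t / 2 ^ i := Nat.div_pos hle (by positivity)
      have : 0 < 2 ^ i * (L.t / 2 ^ i) := by positivity
      dsimp only at h0
      omega
  refine ⟨L₂, h₂, ?_, ht₂.trans ht₁, ?_, ?_⟩
  · intro i s hs hst
    rcases (L₂.pending (Insert.insert p S) i s).eq_empty_or_nonempty with he | ⟨q, hq⟩
    · rw [he]; simp
    have hpos : 0 < (L₂.pending (Insert.insert p S) i s).card := Finset.card_pos.2 ⟨q, hq⟩
    obtain ⟨-, hqs, hqi⟩ := mem_pending.1 hq
    obtain ⟨x, hx⟩ : 2 ^ i ∣ s := hqs ▸ dvd_blockEnd i _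
    have h3 := hp₂ i s
    rw [ht₂, ht₁] at hst ⊢
    rcases Nat.lt_or_ge L.t s with hlt | hge
    · have hs' : s = L.t + 1 := by omega
      have h4 : (L₁.pending (Insert.insert p S) i s).card ≤ 2 ^ i :=
        (Finset.card_le_card (Finset.filter_subset _ _)).trans (card_block_le h₁.τ_inj hs)
      omega
    · rw [hp₁ i s hge] at h3
      have h4 := hd i s hs hge
      -- By the schedule, a block with pending points has age below `2 ^ i`, so it is the latest of
      -- its level and occurs in `l`.
      have hts : L.t < s + 2 ^ i := by omega
      have hmem : (i, s) ∈ l := by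
        refine List.mem_map.2 ⟨i, List.mem_range'_1.2 ⟨by omega, ?_⟩, ?_⟩
        · have h5 : 2 ^ i ≤ L.t := (Nat.le_of_dvd hs ⟨x, hx⟩).trans hge
          have := (Nat.le_log_iff_pow_le one_lt_two (by omega)).2 h5
          omega
        · have : L.t / 2 ^ i = x := by
            apply Nat.div_eq_of_lt_le
            · rw [mul_comm, ← hx]; exact hge
            · rw [add_mul, one_mul, mul_comm, ← hx]; exact hts
          rw [this, hx]
      have := List.count_pos_iff.2 hmem
      omega
  · have := hp₂ 1 0
    rw [hp₁ 1 0 (Nat.zero_le _)] at this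
    omega
  · have h3 := changes_triangle S L.color L₁.color L₂.color
    rw [changes_eq_zero fun q hq => (hc₁ q hq).symm] at h3
    have h4 := changes_mono (Finset.subset_insert p S) L₁.color L₂.color
    simp only [hl, List.length_map, List.length_range'] at hc₂
    omega

/-- At each level, only few blocks are in use. -/
lemma OnSchedule.lt_pos_add (hd : L.OnSchedule S) {p : Point} (hp : p ∈ S)
    (h0 : L.τ p ≠ 0) : L.t < L.pos p + 4 * 2 ^ L.lvl p := by
  by_contra hcon
  have h1 := le_blockEnd (L.lvl p) (L.τ p)
  have h2 := blockEnd_lt (L.lvl p + 1) (L.τ p)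
  have h3 := le_blockEnd (L.lvl p + 1) (L.τ p)
  have hpow : 2 ^ (L.lvl p + 1) = 2 * 2 ^ L.lvl p := pow_succ' _ _
  unfold pos at hcon
  -- The point is pending in its block one level up, which starts less than `2 * 2 ^ L.lvl p` after
  -- its insertion. With the negated bound, that block is old enough to have no pending points.
  have h4 := hd (L.lvl p + 1) (blockEnd (L.lvl p + 1) (L.τ p)) (by omega) (by omega)
  have h5 : 0 < (L.pending S (L.lvl p + 1) (blockEnd (L.lvl p + 1) (L.τ p))).card :=
    Finset.card_pos.2 ⟨p, mem_pending.2 ⟨hp, rfl, Nat.lt_succ_self _⟩⟩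
  omega

/-- Colors come from the old palette, from block `(1, 0)` that receives the initial points, and from
at most four blocks on each of the `Nat.log 2 L.t + 1` levels. -/
lemma WellFormed.numColors_le (h : L.WellFormed S n₀ m) (hd : L.OnSchedule S) :
    numColors S L.color ≤ ((L.block S 0 0).image (L.c 0 0)).card + staticBound n₀ +
      4 * (Nat.log 2 L.t + 1) * staticBound L.t := by
  classical
  set idx : Finset (ℕ × ℕ) := ((Finset.range (Nat.log 2 L.t + 1) ×ˢ Finset.range 4).image
    fun x => (x.1, 2 ^ x.1 * (L.t / 2 ^ x.1 - x.2))).filter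
      fun b => 0 < b.2 ∧ b.2 ≤ L.t ∧ 2 ^ b.1 ≤ L.t with hidx
  set shift : ℕ → ℕ → Finset ℕ := fun i s =>
    ((L.block S i s).image (L.c i s)).image fun k => L.N + Nat.pair (Nat.pair i s) k with hshift
  have hcover : S.image L.color ⊆ ((L.block S 0 0).image (L.c 0 0) ∪ shift 1 0) ∪
      idx.biUnion fun b => shift b.1 b.2 := by
    intro k hk
    obtain ⟨p, hp, rfl⟩ := Finset.mem_image.1 hk
    have hself : ¬(L.lvl p = 0 ∧ L.τ p = 0) → L.color p ∈ shift (L.lvl p) (L.pos p) := by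
      intro hno
      rw [color, if_neg hno]
      exact Finset.mem_image_of_mem _ (Finset.mem_image_of_mem _ (mem_block_self hp))
    by_cases h0 : L.τ p = 0
    · refine Finset.mem_union_left _ ?_
      have hpos : L.pos p = 0 := by rw [pos, h0, blockEnd_zero_right]
      by_cases hl : L.lvl p = 0
      · refine Finset.mem_union_left _ ?_
        rw [color, if_pos ⟨hl, h0⟩]
        exact Finset.mem_image_of_mem _ (mem_block.2 ⟨hp, by simp [h0], hl.le⟩)
      · have hl1 : L.lvl p = 1 := by
          have := h.old_lvl p hp h0
          omega
        have := hself fun h => hl h.1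
        rw [hl1, hpos] at this
        exact Finset.mem_union_right _ this
    · refine Finset.mem_union_right _ (Finset.mem_biUnion.2 ⟨(L.lvl p, L.pos p), ?_,
        hself fun h => h0 h.2⟩)
      have hlt := hd.lt_pos_add hp h0
      have hle := h.started p hp
      have hpos : 0 < L.pos p := by
        have := le_blockEnd (L.lvl p) (L.τ p)
        unfold pos
        omega
      obtain ⟨x, hx⟩ : 2 ^ L.lvl p ∣ L.pos p := dvd_blockEnd _ _
      have hpow : 0 < 2 ^ L.lvl p := by positivity
      have hpt : 2 ^ L.lvl p ≤ L.t := (Nat.le_of_dvd hpos ⟨x, hx⟩).trans hle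
      have hx1 : x ≤ L.t / 2 ^ L.lvl p := by
        rw [Nat.le_div_iff_mul_le hpow, mul_comm, ← hx]; exact hle
      have hx2 : L.t / 2 ^ L.lvl p < x + 4 := by
        rw [Nat.div_lt_iff_lt_mul hpow, add_mul, mul_comm x, ← hx]; exact hlt
      refine Finset.mem_filter.2 ⟨Finset.mem_image.2 ⟨(L.lvl p, L.t / 2 ^ L.lvl p - x),
        Finset.mem_product.2 ⟨Finset.mem_range.2 ?_, Finset.mem_range.2 ?_⟩, ?_⟩, hpos, hle, hpt⟩
      · exact Nat.lt_succ_of_le ((Nat.le_log_iff_pow_le one_lt_two (by omega)).2 hpt)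
      · dsimp only
        omega
      · dsimp only
        rw [Nat.sub_sub_self hx1, ← hx]
  have hidx_card : idx.card ≤ 4 * (Nat.log 2 L.t + 1) := by
    refine (Finset.card_filter_le _ _).trans (Finset.card_image_le.trans ?_)
    rw [Finset.card_product, Finset.card_range, Finset.card_range, mul_comm]
  refine (Finset.card_le_card hcover).trans ((Finset.card_union_le _ _).trans
    (Nat.add_le_add ((Finset.card_union_le _ _).trans (Nat.add_le_add le_rfl
      (Finset.card_image_le.trans h.palette_top))) ?_))
  refine (Finset.card_biUnion_le_card_mul _ _ (staticBound L.t) fun b hb => ?_).trans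
    (Nat.mul_le_mul_right _ hidx_card)
  obtain ⟨-, h1, h2, h3⟩ := Finset.mem_filter.1 hb
  exact Finset.card_image_le.trans ((h.palette _ _ h1 h2).trans (staticBound_mono h3))

end Layout

/-! ### Phases -/

/-- A bound for the number of colors at the start of a phase with `n` points. -/
def phaseBound (n : ℕ) : ℕ :=
  staticBound (2 * n + 2) + 4 * (Nat.log 2 (n + 2) + 1) * staticBound (n + 2)

lemma phaseBound_mono : Monotone phaseBound := fun a b h => by
  unfold phaseBound
  gcongr
  · exact staticBound_mono (by omega)
  · exact staticBound_mono (by omega)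

/-- A layout together with the number of points at the start of the phase and the number of
updates in the phase. -/
structure State where
  /-- the layout -/
  L : Layout
  /-- number of points at the start of the phase -/
  n₀ : ℕ
  /-- number of updates in the phase -/
  u : ℕ

/-- The invariants between updates. -/
structure State.Valid (S : Finset Point) (x : State) : Prop where
  wf : x.L.WellFormed S x.n₀ (phaseBound x.n₀)
  sched : x.L.OnSchedule S
  old : (x.L.pending S 1 0).card ≤ x.n₀ - 2 * x.u
  u_le : 2 * x.u ≤ x.n₀ + 2
  t_le : x.L.t ≤ x.u
  n₀_le : x.n₀ ≤ S.card + x.u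

namespace State

variable {S : Finset Point} {x : State}

/-- The invariants force `x.n₀ ≤ 2 * S.card + 2` and `x.L.t ≤ S.card + 2`, which explains the
arguments in `phaseBound`. -/
lemma Valid.numColors_le (h : x.Valid S) :
    numColors S x.L.color ≤
      ((x.L.block S 0 0).image (x.L.c 0 0)).card + phaseBound S.card := by
  have h1 := h.wf.numColors_le h.sched
  have h2 := h.u_le
  have h3 := h.t_le
  have h4 := h.n₀_le
  have h5 : staticBound x.n₀ ≤ staticBound (2 * S.card + 2) := staticBound_mono (by omega)
  have h6 : 4 * (Nat.log 2 x.L.t + 1) * staticBound x.L.t ≤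
      4 * (Nat.log 2 (S.card + 2) + 1) * staticBound (S.card + 2) := by
    have ht : x.L.t ≤ S.card + 2 := by omega
    have := staticBound_mono ht
    gcongr
  unfold phaseBound
  omega

/-- All points start at level `0` with the given coloring and are pending for a fresh static
coloring at level `1`. The offset `S.sup c + 1` keeps later colors apart from the old ones. -/
lemma exists_start {c : Point → ℕ} (hc : Layered S c)
    (hcard : (S.image c).card ≤ phaseBound S.card) :
    ∃ x : State, x.Valid S ∧ x.u = 0 ∧ ∀ p ∈ S, x.L.color p = c p := by
  classical
  obtain ⟨k, hk, hkc⟩ := exists_layered S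
  set L : Layout := ⟨0, S.sup c + 1, fun _ => 0, fun _ => 0, fun i _ => if i = 0 then c else k⟩
    with hL
  have hblock : ∀ i, L.block S i 0 = S := fun i =>
    Finset.filter_true_of_mem fun p _ => by simp [hL]
  have hpos : ∀ p, L.pos p = 0 := fun p => by simp [Layout.pos, hL]
  refine ⟨⟨L, S.card, 0⟩, ⟨⟨fun p _ => (hpos p).le, ?_, ?_, ?_, fun p _ _ => Nat.zero_le _,
    fun p _ q _ _ h => absurd rfl h, ?_, ?_, ?_⟩, ?_, ?_, Nat.zero_le _, le_rfl, le_rfl⟩, rfl, ?_⟩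
  · intro i s hs
    obtain rfl : s = 0 := Nat.le_zero.1 hs
    show Layered (L.block S i 0) _
    rw [hblock]
    by_cases hi : i = 0
    · simpa [hL, hi] using hc
    · simpa [hL, hi] using hk
  · intro i s _ p _ q _ _ h
    exact h
  · intro p hp
    exact Nat.lt_succ_of_le (Finset.le_sup (f := c) (Layout.mem_block.1 hp).1)
  · intro i s h1 h2
    exact absurd (h1.trans_le h2) (lt_irrefl 0)
  · show ((L.block S 1 0).image _).card ≤ _
    rw [hblock]
    simpa [hL] using hkc
  · show ((L.block S 0 0).image _).card ≤ _
    rw [hblock]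
    simpa [hL] using hcard
  · intro i s h1 h2
    exact absurd (h1.trans_le h2) (lt_irrefl 0)
  · exact Finset.card_le_card ((Finset.filter_subset _ _).trans (Finset.filter_subset _ _))
  · intro p _
    simp [Layout.color, hL]

/-- When all old points have been moved, a new phase is started. -/
lemma Valid.refresh (h : x.Valid S) :
    ∃ y : State, y.Valid S ∧ 2 * y.u ≤ y.n₀ ∧ ∀ p ∈ S, y.L.color p = x.L.color p := by
  -- After `n₀ / 2` updates no point has an old color, so the color count is at most `phaseBound
  -- S.card`. This keeps palettes from accumulating over phases, and the restart itself recolors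
  -- nothing.
  rcases Nat.lt_or_ge (2 * x.u) x.n₀ with hlt | hge
  · exact ⟨x, h, hlt.le, fun _ _ => rfl⟩
  · have hempty : x.L.block S 0 0 = ∅ := by
      have h1 : x.L.pending S 1 0 = ∅ := by
        rw [← Finset.card_eq_zero]
        have := h.old
        omega
      rw [Finset.eq_empty_iff_forall_notMem] at h1 ⊢
      intro p hp
      obtain ⟨h2, h3, h4⟩ := Layout.mem_block.1 hp
      rw [blockEnd_eq_zero] at h3
      exact h1 p (Layout.mem_pending.2 ⟨h2, by rw [h3, blockEnd_zero_right], by omega⟩)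
    have h2 := h.numColors_le
    rw [hempty, Finset.image_empty, Finset.card_empty, zero_add] at h2
    obtain ⟨y, hy, hyu, hyc⟩ := exists_start h.wf.layered_color h2
    exact ⟨y, hy, by omega, hyc⟩

/-- Two moves per update exhaust the initial points while the current set is still comparable in
size with `n₀`. -/
lemma moves_old {L : Layout} {n₀ m : ℕ} (h : L.WellFormed S n₀ m) (hd : L.OnSchedule S) :
    ∃ L' : Layout, L'.WellFormed S n₀ m ∧ L'.OnSchedule S ∧ L'.t = L.t ∧
      (L'.pending S 1 0).card ≤ (L.pending S 1 0).card - 2 ∧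
      changes S L.color L'.color ≤ 4 := by
  obtain ⟨L', h', ht, hp, hc⟩ := h.moves [(1, 0), (1, 0)] L (by simp)
  refine ⟨L', h', fun i s hs hst => ?_, ht, by simpa using hp 1 0, by simpa using hc⟩
  rw [ht] at hst ⊢
  exact (hp i s).trans ((Nat.sub_le _ _).trans (hd i s hs hst))

lemma Valid.insert (h : x.Valid S) {p : Point} (hp : p ∉ S) :
    ∃ y : State, y.Valid (insert p S) ∧
      changes S x.L.color y.L.color ≤ 2 * Nat.log 2 (S.card + 2) + 4 := by
  obtain ⟨x₁, h₁, hu₁, hc₁⟩ := h.refresh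
  obtain ⟨L₂, h₂, hd₂, ht₂, hp₂, hc₂⟩ := h₁.wf.insert h₁.sched hp
  obtain ⟨L₃, h₃, hd₃, ht₃, hp₃, hc₃⟩ := moves_old h₂ hd₂
  have h4 := h₁.old
  have h5 := h₁.t_le
  have h6 := h₁.n₀_le
  refine ⟨⟨L₃, x₁.n₀, x₁.u + 1⟩, ⟨h₃, hd₃, ?_, ?_, ?_, ?_⟩, ?_⟩
  · show (L₃.pending (Insert.insert p S) 1 0).card ≤ x₁.n₀ - 2 * (x₁.u + 1)
    omega
  · show 2 * (x₁.u + 1) ≤ x₁.n₀ + 2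
    omega
  · show L₃.t ≤ x₁.u + 1
    omega
  · show x₁.n₀ ≤ (Insert.insert p S).card + (x₁.u + 1)
    rw [Finset.card_insert_of_notMem hp]
    omega
  · have h7 := changes_triangle S x.L.color x₁.L.color L₃.color
    have h8 := changes_triangle S x₁.L.color L₂.color L₃.color
    have h9 := changes_mono (Finset.subset_insert p S) L₂.color L₃.color
    have h10 : Nat.log 2 x₁.L.t ≤ Nat.log 2 (S.card + 2) := Nat.log_mono_right (by omega)
    rw [changes_eq_zero fun q hq => (hc₁ q hq).symm] at h7
    show changes S x.L.color L₃.color ≤ _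
    omega

lemma Valid.delete (h : x.Valid S) {p : Point} (hp : p ∈ S) :
    ∃ y : State, y.Valid (S.erase p) ∧ changes (S.erase p) x.L.color y.L.color ≤ 5 := by
  obtain ⟨x₁, h₁, hu₁, hc₁⟩ := h.refresh
  obtain ⟨L₂, h₂, ht₂, hp₂, hc₂⟩ := h₁.wf.delete p
  obtain ⟨L₃, h₃, hd₃, ht₃, hp₃, hc₃⟩ := moves_old h₂ fun i s hs hst => by
    rw [ht₂] at hst ⊢
    exact (Finset.card_le_card (hp₂ i s)).trans (h₁.sched i s hs hst)
  have h4 := h₁.old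
  have h5 := h₁.t_le
  have h6 := h₁.n₀_le
  have h7 := Finset.card_le_card (hp₂ 1 0)
  refine ⟨⟨L₃, x₁.n₀, x₁.u + 1⟩, ⟨h₃, hd₃, ?_, ?_, ?_, ?_⟩, ?_⟩
  · show (L₃.pending (S.erase p) 1 0).card ≤ x₁.n₀ - 2 * (x₁.u + 1)
    omega
  · show 2 * (x₁.u + 1) ≤ x₁.n₀ + 2
    omega
  · show L₃.t ≤ x₁.u + 1
    omega
  · show x₁.n₀ ≤ (S.erase p).card + (x₁.u + 1)
    have := Finset.card_erase_add_one hp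
    omega
  · have h7 := changes_triangle (S.erase p) x.L.color x₁.L.color L₃.color
    have h8 := changes_triangle (S.erase p) x₁.L.color L₂.color L₃.color
    rw [changes_eq_zero fun q hq => (hc₁ q (Finset.mem_of_mem_erase hq)).symm] at h7
    show changes (S.erase p) x.L.color L₃.color ≤ _
    omega

/-- The factor two accounts for the old palette, whose size was bounded when the phase started, next
to the colors of the current phase. -/
lemma Valid.numColors_le_two_mul (h : x.Valid S) :
    numColors S x.L.color ≤ 2 * phaseBound (2 * S.card + 2) := by
  have h1 := h.numColors_le
  have h2 := h.wf.palette_old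
  have h3 := h.u_le
  have h4 := h.n₀_le
  have h5 : phaseBound x.n₀ ≤ phaseBound (2 * S.card + 2) := phaseBound_mono (by omega)
  have h6 : phaseBound S.card ≤ phaseBound (2 * S.card + 2) := phaseBound_mono (by omega)
  omega

end State

/-! ### From invariants to a strategy; numerical bounds -/

/-- A strategy is obtained from an invariant that can be maintained. -/
lemma exists_run {X : Type*} (S₀ : Finset Point) (I : Finset Point → X → Prop)
    (Q : Update → Finset Point → X → X → Prop) (init : ∃ x, I S₀ x)
    (step : ∀ u S x, I S x → u.IsAdmissible S → ∃ y, I (u.apply S) y ∧ Q u S x y) :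
    ∃ run : History → X, (∀ h, IsValid S₀ h → I (currentSet S₀ h) (run h)) ∧
      ∀ u h, IsValid S₀ (u :: h) → Q u (currentSet S₀ h) (run h) (run (u :: h)) := by
  classical
  obtain ⟨x₀, hx₀⟩ := init
  have hex : ∀ u S x, ∃ y, I S x → u.IsAdmissible S → I (u.apply S) y ∧ Q u S x y := by
    intro u S x
    by_cases h : I S x ∧ u.IsAdmissible S
    · obtain ⟨y, hy⟩ := step u S x h.1 h.2
      exact ⟨y, fun _ _ => hy⟩
    · exact ⟨x, fun h1 h2 => absurd ⟨h1, h2⟩ h⟩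
  choose next hnext using hex
  let run : History → X := fun h => List.rec x₀ (fun u h y => next u (currentSet S₀ h) y) h
  have hI : ∀ h, IsValid S₀ h → I (currentSet S₀ h) (run h) := by
    intro h
    induction h with
    | nil => exact fun _ => hx₀
    | cons u h ih => exact fun hv => (hnext u _ _ (ih hv.1) hv.2).1
  exact ⟨run, hI, fun u h hv => (hnext u _ _ (hI h hv.1) hv.2).2⟩

lemma natLog_le_two_mul_log {n : ℕ} (hn : 2 ≤ n) : (Nat.log 2 n : ℝ) ≤ 2 * Real.log n := by
  have h1 : (2 : ℝ) ^ Nat.log 2 n ≤ n := by exact_mod_cast Nat.pow_log_le_self 2 (by omega)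
  have h2 := Real.log_le_log (by positivity) h1
  rw [Real.log_pow] at h2
  have h3 := Real.log_two_gt_d9
  have h4 : (0 : ℝ) ≤ Nat.log 2 n := Nat.cast_nonneg _
  nlinarith

lemma one_le_natLog {n : ℕ} (hn : 2 ≤ n) : 1 ≤ Nat.log 2 n :=
  (Nat.le_log_iff_pow_le one_lt_two (by omega)).2 (by simpa using hn)

/-- All arguments are enlarged to `8n`, whose binary logarithm is exactly `Nat.log 2 n + 3`. The
constant is `21 * 30 * 4`, the last factor from squaring `Nat.log 2 n ≤ 2 * Real.log n`. -/
lemma phaseBound_le {n : ℕ} (hn : 2 ≤ n) :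
    (phaseBound (2 * n + 2) : ℝ) ≤ 2520 * (Real.sqrt n * Real.log n ^ 2) := by
  have hl := one_le_natLog hn
  have hlog : Nat.log 2 (n * 2 * 2 * 2) = Nat.log 2 n + 3 := by
    rw [Nat.log_mul_base one_lt_two (by omega), Nat.log_mul_base one_lt_two (by omega),
      Nat.log_mul_base one_lt_two (by omega)]
  have h1 : phaseBound (2 * n + 2) ≤ 21 * Nat.log 2 n * staticBound (n * 2 * 2 * 2) := by
    have h2 : staticBound (2 * (2 * n + 2) + 2) ≤ staticBound (n * 2 * 2 * 2) :=
      staticBound_mono (by omega)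
    have h3 : staticBound (2 * n + 2 + 2) ≤ staticBound (n * 2 * 2 * 2) :=
      staticBound_mono (by omega)
    have h4 : Nat.log 2 (2 * n + 2 + 2) ≤ Nat.log 2 n + 3 := by
      rw [← hlog]; exact Nat.log_mono_right (by omega)
    calc phaseBound (2 * n + 2)
        ≤ staticBound (n * 2 * 2 * 2) +
          4 * (Nat.log 2 n + 3 + 1) * staticBound (n * 2 * 2 * 2) := by
          unfold phaseBound
          gcongr
      _ = (1 + 4 * (Nat.log 2 n + 3 + 1)) * staticBound (n * 2 * 2 * 2) := by ring
      _ ≤ _ := Nat.mul_le_mul_right _ (by omega)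
  have h2 : (staticBound (n * 2 * 2 * 2) : ℝ) ≤ 30 * (Real.sqrt n * Nat.log 2 n) := by
    have h3 : (Nat.sqrt (n * 2 * 2 * 2) : ℝ) ≤ 3 * Real.sqrt n := by
      refine Real.nat_sqrt_le_real_sqrt.trans (Real.sqrt_le_iff.2 ⟨by positivity, ?_⟩)
      rw [mul_pow, Real.sq_sqrt (Nat.cast_nonneg n)]
      push_cast
      have : (0 : ℝ) ≤ n := Nat.cast_nonneg n
      linarith
    have h4 : ((Nat.log 2 n + 3 + 1 : ℕ) : ℝ) ≤ 5 * Nat.log 2 n := by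
      exact_mod_cast (by omega : Nat.log 2 n + 3 + 1 ≤ 5 * Nat.log 2 n)
    calc (staticBound (n * 2 * 2 * 2) : ℝ)
        = 2 * (Nat.sqrt (n * 2 * 2 * 2) : ℝ) * ((Nat.log 2 n + 3 + 1 : ℕ) : ℝ) := by
          unfold staticBound
          rw [hlog]
          push_cast
          ring
      _ ≤ 2 * (3 * Real.sqrt n) * (5 * Nat.log 2 n) := by gcongr
      _ = _ := by ring
  have h3 := natLog_le_two_mul_log hn
  have h4 : (0 : ℝ) ≤ Nat.log 2 n := Nat.cast_nonneg _
  calc (phaseBound (2 * n + 2) : ℝ)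
      ≤ 21 * Nat.log 2 n * staticBound (n * 2 * 2 * 2) := by exact_mod_cast h1
    _ ≤ 21 * Nat.log 2 n * (30 * (Real.sqrt n * Nat.log 2 n)) := by gcongr
    _ = 630 * (Real.sqrt n * (Nat.log 2 n : ℝ) ^ 2) := by ring
    _ ≤ 630 * (Real.sqrt n * (2 * Real.log n) ^ 2) := by gcongr
    _ = _ := by ring

end DynamicCF

open DynamicCF

theorem mainTheorem8 :
    ∃ C : ℝ, ∀ S₀ : Finset DynamicCF.Point, ∃ σ : DynamicCF.Strategy,
      -- the coloring is conflict-free at any time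
      (∀ h : DynamicCF.History, DynamicCF.IsValid S₀ h →
        DynamicCF.IsConflictFree DynamicCF.rectangles (DynamicCF.currentSet S₀ h) (σ h)) ∧
      -- the number of colors at any time is `O(√n log² n)`, with `n` the current number of points
      (∀ h : DynamicCF.History, DynamicCF.IsValid S₀ h →
        ∀ n : ℕ, n = (DynamicCF.currentSet S₀ h).card → 2 ≤ n →
          (DynamicCF.numColors (DynamicCF.currentSet S₀ h) (σ h) : ℝ)
            ≤ C * (Real.sqrt n * Real.log n ^ 2)) ∧
      -- `O(log n)` recolorings per insertion, with `n` the number of points after the insertion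
      (∀ (p : DynamicCF.Point) (h : DynamicCF.History),
        DynamicCF.IsValid S₀ (DynamicCF.Update.insert p :: h) →
          ∀ n : ℕ, n = (DynamicCF.currentSet S₀ (DynamicCF.Update.insert p :: h)).card →
            (DynamicCF.numRecolorings S₀ σ (DynamicCF.Update.insert p) h : ℝ)
              ≤ C * Real.log n) ∧
      -- `O(1)` recolorings per deletion
      (∀ (p : DynamicCF.Point) (h : DynamicCF.History),
        DynamicCF.IsValid S₀ (DynamicCF.Update.delete p :: h) →
          (DynamicCF.numRecolorings S₀ σ (DynamicCF.Update.delete p) h : ℝ) ≤ C) := by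
  -- Twice the constant of `phaseBound_le`; the recoloring bounds need far less.
  refine ⟨5040, fun S₀ => ?_⟩
  obtain ⟨run, hI, hQ⟩ := exists_run S₀ (fun S x => State.Valid S x)
    (fun u S x y => changes (S ∩ u.apply S) x.L.color y.L.color ≤
      match u with
      | .insert _ => 2 * Nat.log 2 (S.card + 2) + 4
      | .delete _ => 5)
    (by
      obtain ⟨c, hc, hcard⟩ := exists_layered S₀
      obtain ⟨x, hx, -⟩ := State.exists_start hc (hcard.trans
        ((staticBound_mono (by omega)).trans (Nat.le_add_right _ _)))
      exact ⟨x, hx⟩)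
    (by
      rintro (p | p) S x hx hu
      · obtain ⟨y, hy, hc⟩ := hx.insert hu
        exact ⟨y, hy, (changes_mono Finset.inter_subset_left _ _).trans hc⟩
      · obtain ⟨y, hy, hc⟩ := hx.delete hu
        exact ⟨y, hy, (changes_mono Finset.inter_subset_right _ _).trans hc⟩)
  refine ⟨fun h => (run h).L.color, fun h hv => (hI h hv).wf.layered_color.isConflictFree, ?_, ?_,
    ?_⟩
  · rintro h hv n rfl hn
    have h1 := (hI h hv).numColors_le_two_mul
    have h2 := phaseBound_le hn
    calc (numColors (currentSet S₀ h) (run h).L.color : ℝ)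
        ≤ 2 * (phaseBound (2 * (currentSet S₀ h).card + 2) : ℝ) := by exact_mod_cast h1
      _ ≤ _ := by linarith
  · intro p h hv n hn
    have h1 : numRecolorings S₀ (fun h => (run h).L.color) (Update.insert p) h ≤
        2 * Nat.log 2 ((currentSet S₀ h).card + 2) + 4 := hQ _ h hv
    have h2 : n = (currentSet S₀ h).card + 1 := by
      rw [hn]
      exact Finset.card_insert_of_notMem hv.2
    -- For `n = 1` the bound is `0`, and indeed no earlier point exists that could be recolored.
    rcases Nat.lt_or_ge n 2 with hlt | hge
    · have h3 : currentSet S₀ h = ∅ := Finset.card_eq_zero.1 (by omega)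
      have h4 : n = 1 := by omega
      simp [numRecolorings, h3, h4]
    · have h3 : Nat.log 2 ((currentSet S₀ h).card + 2) ≤ Nat.log 2 n + 1 := by
        rw [← Nat.log_mul_base one_lt_two (by omega)]
        exact Nat.log_mono_right (by omega)
      have h4 := one_le_natLog hge
      have h5 := natLog_le_two_mul_log hge
      have h6 : (numRecolorings S₀ (fun h => (run h).L.color) (Update.insert p) h : ℝ) ≤
          8 * Nat.log 2 n := by
        exact_mod_cast h1.trans (by omega)
      have h7 : (0 : ℝ) ≤ Real.log n := Real.log_natCast_nonneg n
      linarith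
  · intro p h hv
    have h1 : numRecolorings S₀ (fun h => (run h).L.color) (Update.delete p) h ≤ 5 := hQ _ h hv
    calc (numRecolorings S₀ (fun h => (run h).L.color) (Update.delete p) h : ℝ)
        ≤ 5 := by exact_mod_cast h1
      _ ≤ 5040 := by norm_num
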